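/- Let $p$ be a prime and let $d, u$ be positive integers, with $u \ge 2$ if $p = 2$. Let $\mathbb{Z}_p$ be the ring of $p$-adic integers and let $$\Gamma = \{A \in \mathrm{Mat}_d(\mathbb{Z}_p) \mid A \equiv I_d \bmod p^u\},$$ a group under matrix multiplication. Let $k$ be a field of characteristic $p$, let $k[\Gamma]$ be the group ring of the (abstract) group $\Gamma$, and let $\omega(\Gamma)$ be its augmentation ideal, that is, the kernel of the map $k[\Gamma] \to k$, $\sum_g a_g g \mapsto \sum_g a_g$, with the convention $\omega(\Gamma)^0 = k[\Gamma]$. Put $e = d^2$. Then: 1. the associated graded ring $\mathrm{gr}(k[\Gamma]) = \bigoplus_{i=0}^{\infty} \omega(\Gamma)^i/\omega(\Gamma)^{i+1}$ is isomorphic, as a graded $k$-algebra, to the polynomial ring over $k$ in $e$ variables, each of degree $1$; 2. $\bigcap_{i \ge 0} \omega(\Gamma)^i = 0$; 3. $k[\Gamma]$ is a domain (a nonzero ring, not necessarily commutative, without zero divisors). -/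

import Mathlib

open scoped DirectSum

noncomputable section

/-! ### Congruence subgroups -/

/-- `A ≡ 1 mod p ^ i`, entrywise, for a square matrix `A` over the `p`-adic integers. -/
def CongruentToOne (i d p : ℕ) [Fact p.Prime] (A : Matrix (Fin d) (Fin d) ℤ_[p]) : Prop :=
  ∀ a b, (p : ℤ_[p]) ^ i ∣ (A - 1) a b

theorem CongruentToOne.mul {i d p : ℕ} [Fact p.Prime] {A B : Matrix (Fin d) (Fin d) ℤ_[p]}
    (hA : CongruentToOne i d p A) (hB : CongruentToOne i d p B) :
    CongruentToOne i d p (A * B) := by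
  intro a b
  have h : A * B - 1 = (A - 1) * B + (B - 1) := by noncomm_ring
  rw [h, Matrix.add_apply, Matrix.mul_apply]
  exact dvd_add (Finset.dvd_sum fun c _ => (hA a c).mul_right _) (hB a b)

theorem CongruentToOne.of_mul_eq_one {i d p : ℕ} [Fact p.Prime]
    {A B : Matrix (Fin d) (Fin d) ℤ_[p]}
    (hA : CongruentToOne i d p A) (hAB : A * B = 1) : CongruentToOne i d p B := by
  intro a b
  have h : B - 1 = -((A - 1) * B) := by rw [sub_mul, hAB]; noncomm_ring
  rw [h, Matrix.neg_apply, Matrix.mul_apply]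
  exact (Finset.dvd_sum fun c _ => (hA a c).mul_right _).neg_right

/-- The congruence subgroup `CS(i,d,p) = {A ∈ Mat_d(ℤ_p) | A ≡ 1 mod p ^ i}`, as a subgroup of
`GL_d(ℤ_p)`. For `i ≥ 1` invertibility is automatic: see `exists_mem_congruenceSubgroup`. -/
def congruenceSubgroup (i d p : ℕ) [Fact p.Prime] :
    Subgroup (Matrix.GeneralLinearGroup (Fin d) ℤ_[p]) where
  carrier := {A | CongruentToOne i d p (A : Matrix (Fin d) (Fin d) ℤ_[p])}
  one_mem' := fun a b => by simp
  mul_mem' := fun hA hB => CongruentToOne.mul hA hB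
  inv_mem' := fun {A} hA => CongruentToOne.of_mul_eq_one hA A.mul_inv

/-- For `i ≥ 1`, every matrix congruent to `1` modulo `p ^ i` is invertible, so the underlying set
of `congruenceSubgroup i d p` is the set of all matrices `A ∈ Mat_d(ℤ_p)` with
`A ≡ 1 mod p ^ i`. -/
theorem exists_mem_congruenceSubgroup {i d p : ℕ} [Fact p.Prime] (hi : 0 < i)
    {A : Matrix (Fin d) (Fin d) ℤ_[p]} (hA : CongruentToOne i d p A) :
    ∃ g ∈ congruenceSubgroup i d p, (g : Matrix (Fin d) (Fin d) ℤ_[p]) = A := by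
  have hu : IsUnit A := by
    rw [Matrix.isUnit_iff_isUnit_det]
    by_contra h
    have h1 : (PadicInt.toZMod (p := p)) A.det = 0 := by
      rw [← RingHom.mem_ker, PadicInt.ker_toZMod]
      exact (IsLocalRing.mem_maximalIdeal _).2 h
    rw [RingHom.map_det] at h1
    have h2 : (PadicInt.toZMod (p := p)).mapMatrix A = 1 := by
      rw [← sub_eq_zero, ← map_one (PadicInt.toZMod (p := p)).mapMatrix, ← map_sub]
      ext a b
      obtain ⟨c, hc⟩ := (dvd_pow_self (p : ℤ_[p]) hi.ne').trans (hA a b)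
      simp only [RingHom.mapMatrix_apply, Matrix.map_apply, hc, map_mul, map_natCast,
        CharP.cast_eq_zero, zero_mul, Matrix.zero_apply]
    rw [h2, Matrix.det_one] at h1
    exact one_ne_zero h1
  obtain ⟨g, rfl⟩ := hu
  exact ⟨g, hA, rfl⟩

/-! ### The augmentation ideal of a group ring -/

/-- The augmentation ideal `ω(G)` of `k[G]`: the kernel of the augmentation map
`k[G] → k`, `∑ a_g g ↦ ∑ a_g`. -/
def augIdeal (k G : Type*) [Field k] [Group G] : Ideal (MonoidAlgebra k G) :=
  RingHom.ker (MonoidAlgebra.lift k k G (1 : G →* k))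

instance augIdeal_isTwoSided (k G : Type*) [Field k] [Group G] :
    (augIdeal k G).IsTwoSided := by
  unfold augIdeal; infer_instance

theorem mem_augIdeal {k G : Type*} [Field k] [Group G] (a : MonoidAlgebra k G) :
    a ∈ augIdeal k G ↔ a.coeff.sum (fun _ c => c) = 0 := by
  simp [augIdeal, RingHom.mem_ker, MonoidAlgebra.lift_apply]

/-! ### The associated graded ring of the powers of a two-sided ideal -/

section Graded

variable {R : Type*} [Ring R] (I : Ideal R)

/-- The `n`-th graded piece `I ^ n / I ^ (n + 1)` (with `I ^ 0 = R`). -/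
abbrev GrPiece (n : ℕ) : Type _ :=
  ↥(I ^ n) ⧸ Submodule.comap (I ^ n).subtype (I ^ (n + 1))

/-- The class in `I ^ n / I ^ (n + 1)` of an element of `I ^ n`. -/
def GrPiece.mk (n : ℕ) (x : ↥(I ^ n)) : GrPiece I n :=
  Submodule.Quotient.mk x

theorem GrPiece.mk_eq_mk {n : ℕ} {x y : ↥(I ^ n)} :
    GrPiece.mk I n x = GrPiece.mk I n y ↔ (x - y : R) ∈ I ^ (n + 1) :=
  Submodule.Quotient.eq _

theorem GrPiece.mk_surjective (n : ℕ) : Function.Surjective (GrPiece.mk I n) :=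
  Submodule.Quotient.mk_surjective _

theorem GrPiece.gradedMk_eq {m n : ℕ} (h : m = n) {x : ↥(I ^ m)} {y : ↥(I ^ n)}
    (hxy : (x : R) = y) :
    (GradedMonoid.mk m (GrPiece.mk I m x) : GradedMonoid (GrPiece I)) =
      GradedMonoid.mk n (GrPiece.mk I n y) := by
  subst h
  rw [Subtype.ext hxy]

/-- The product of an element of `I ^ m` and an element of `I ^ n`, as an element of
`I ^ (m + n)`. -/
def powMul [I.IsTwoSided] {m n : ℕ} (x : ↥(I ^ m)) (y : ↥(I ^ n)) : ↥(I ^ (m + n)) :=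
  ⟨x * y, by rw [Ideal.IsTwoSided.pow_add]; exact Ideal.mul_mem_mul x.2 y.2⟩

/-- Multiplication `I ^ m / I ^ (m + 1) × I ^ n / I ^ (n + 1) → I ^ (m + n) / I ^ (m + n + 1)`,
induced by multiplication of representatives. -/
def GrPiece.mul [I.IsTwoSided] {m n : ℕ} : GrPiece I m → GrPiece I n → GrPiece I (m + n) :=
  Quotient.map₂ (powMul I) (by
    intro x x' hx y y' hy
    replace hx : (x - x' : R) ∈ I ^ (m + 1) :=
      (GrPiece.mk_eq_mk I).1 (Quotient.sound hx)
    replace hy : (y - y' : R) ∈ I ^ (n + 1) :=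
      (GrPiece.mk_eq_mk I).1 (Quotient.sound hy)
    refine Quotient.exact ((GrPiece.mk_eq_mk I).2 ?_)
    have h : ((powMul I x y : R) - powMul I x' y') =
        (x - x' : R) * y + x' * (y - y' : R) := by
      simp only [powMul]; noncomm_ring
    rw [h]
    refine add_mem ?_ ?_
    · rw [show m + n + 1 = (m + 1) + n by omega, Ideal.IsTwoSided.pow_add]
      exact Ideal.mul_mem_mul hx y.2
    · rw [add_assoc, Ideal.IsTwoSided.pow_add]
      exact Ideal.mul_mem_mul x'.2 hy)

theorem GrPiece.mk_mul_mk [I.IsTwoSided] {m n : ℕ} (x : ↥(I ^ m)) (y : ↥(I ^ n)) :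
    GrPiece.mul I (GrPiece.mk I m x) (GrPiece.mk I n y) = GrPiece.mk I (m + n) (powMul I x y) :=
  rfl

/-- An element of `R`, as an element of `I ^ 0 = R`. -/
def powZero (r : R) : ↥(I ^ 0) := ⟨r, by rw [Submodule.pow_zero, Ideal.one_eq_top]; trivial⟩

instance GrPiece.gmul [I.IsTwoSided] : GradedMonoid.GMul (GrPiece I) where
  mul := GrPiece.mul I

instance GrPiece.gone : GradedMonoid.GOne (GrPiece I) where
  one := GrPiece.mk I 0 (powZero I 1)

/-- The graded monoid structure on the pieces `I ^ n / I ^ (n + 1)`. -/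
instance GrPiece.gmonoid [I.IsTwoSided] : GradedMonoid.GMonoid (GrPiece I) where
  one_mul := by
    rintro ⟨n, a⟩
    obtain ⟨a, rfl⟩ := GrPiece.mk_surjective I _ a
    exact GrPiece.gradedMk_eq I (zero_add n) (x := powMul I (powZero I 1) a) (y := a)
      (by simp [powMul, powZero])
  mul_one := by
    rintro ⟨n, a⟩
    obtain ⟨a, rfl⟩ := GrPiece.mk_surjective I _ a
    exact GrPiece.gradedMk_eq I (add_zero n) (x := powMul I a (powZero I 1)) (y := a)
      (by simp [powMul, powZero])
  mul_assoc := by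
    rintro ⟨l, a⟩ ⟨m, b⟩ ⟨n, c⟩
    obtain ⟨a, rfl⟩ := GrPiece.mk_surjective I _ a
    obtain ⟨b, rfl⟩ := GrPiece.mk_surjective I _ b
    obtain ⟨c, rfl⟩ := GrPiece.mk_surjective I _ c
    exact GrPiece.gradedMk_eq I (add_assoc l m n) (x := powMul I (powMul I a b) c)
      (y := powMul I a (powMul I b c)) (by simp [powMul, mul_assoc])

/-- The graded ring structure on `⨁ n, I ^ n / I ^ (n + 1)`. -/
instance GrPiece.gring [I.IsTwoSided] : DirectSum.GRing (GrPiece I) where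
  __ := GrPiece.gmonoid I
  natCast n := GrPiece.mk I 0 (powZero I n)
  intCast n := GrPiece.mk I 0 (powZero I n)
  mul_zero {i j} a := by
    obtain ⟨a, rfl⟩ := GrPiece.mk_surjective I _ a
    exact (GrPiece.mk_eq_mk I (x := powMul I a 0) (y := 0)).2 (by simp [powMul])
  zero_mul {i j} b := by
    obtain ⟨b, rfl⟩ := GrPiece.mk_surjective I _ b
    exact (GrPiece.mk_eq_mk I (x := powMul I 0 b) (y := 0)).2 (by simp [powMul])
  mul_add {i j} a b c := by
    obtain ⟨a, rfl⟩ := GrPiece.mk_surjective I _ a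
    obtain ⟨b, rfl⟩ := GrPiece.mk_surjective I _ b
    obtain ⟨c, rfl⟩ := GrPiece.mk_surjective I _ c
    exact (GrPiece.mk_eq_mk I (x := powMul I a (b + c)) (y := powMul I a b + powMul I a c)).2
      (by simp [powMul, mul_add])
  add_mul {i j} a b c := by
    obtain ⟨a, rfl⟩ := GrPiece.mk_surjective I _ a
    obtain ⟨b, rfl⟩ := GrPiece.mk_surjective I _ b
    obtain ⟨c, rfl⟩ := GrPiece.mk_surjective I _ c
    exact (GrPiece.mk_eq_mk I (x := powMul I (a + b) c) (y := powMul I a c + powMul I b c)).2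
      (by simp [powMul, add_mul])
  natCast_zero := (GrPiece.mk_eq_mk I (x := powZero I (0 : ℕ)) (y := 0)).2 (by simp [powZero])
  natCast_succ n := (GrPiece.mk_eq_mk I (x := powZero I (n + 1 : ℕ))
    (y := powZero I n + powZero I 1)).2 (by simp [powZero])
  intCast_ofNat n := (GrPiece.mk_eq_mk I (x := powZero I (n : ℤ)) (y := powZero I (n : ℕ))).2
    (by simp [powZero])
  intCast_negSucc_ofNat n := (GrPiece.mk_eq_mk I (x := powZero I (Int.negSucc n))
    (y := -powZero I (n + 1 : ℕ))).2 (by simp [powZero])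

/-- If `R` is an algebra over `k`, then so is its associated graded ring; a scalar `c` acts as
the class of `c` in `R / I`. -/
instance GrPiece.galgebra (k : Type*) [CommRing k] [Algebra k R] [I.IsTwoSided] :
    DirectSum.GAlgebra k (GrPiece I) where
  toFun :=
    { toFun := fun c => GrPiece.mk I 0 (powZero I (algebraMap k R c))
      map_zero' := (GrPiece.mk_eq_mk I (y := 0)).2 (by simp [powZero])
      map_add' := fun a b => (GrPiece.mk_eq_mk I
        (y := powZero I (algebraMap k R a) + powZero I (algebraMap k R b))).2
          (by simp [powZero]) }
  map_one := (GrPiece.mk_eq_mk I (y := powZero I 1)).2 (by simp [powZero])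
  map_mul a b := GrPiece.gradedMk_eq I (zero_add 0).symm
    (x := powZero I (algebraMap k R (a * b)))
    (y := powMul I (powZero I (algebraMap k R a)) (powZero I (algebraMap k R b)))
    (by simp [powZero, powMul])
  commutes := by
    rintro c ⟨n, a⟩
    obtain ⟨a, rfl⟩ := GrPiece.mk_surjective I _ a
    exact GrPiece.gradedMk_eq I (by omega)
      (x := powMul I (powZero I (algebraMap k R c)) a)
      (y := powMul I a (powZero I (algebraMap k R c)))
      (by simp [powZero, powMul, Algebra.commutes])
  smul_def := by
    rintro c ⟨n, a⟩
    obtain ⟨a, rfl⟩ := GrPiece.mk_surjective I _ a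
    exact GrPiece.gradedMk_eq I (by omega)
      (x := c • a) (y := powMul I (powZero I (algebraMap k R c)) a)
      (by simp [powZero, powMul, Algebra.smul_def])

/-- The associated graded ring `gr(R) = ⨁ n, I ^ n / I ^ (n + 1)`. -/
abbrev AssocGraded : Type _ := ⨁ n, GrPiece I n

end Graded

end

/-! Write `ω` for the augmentation ideal. The powers of `ω` pair with the polynomial functions on
`Γ`: moving a factor `g - 1` across the pairing becomes a difference operator, so functions killed
by `n` differences kill `ω ^ n` (`evalFun_eq_zero`).

With `g = 1 + p ^ u X`, the entries of `X` are coordinates that are additive up to `p ^ u` times a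
bilinear term. Modulo `p`, the binomial coefficient of `p ^ u y` over `n` is zero or that of `y`
over `n / p ^ u` (Lucas), and `p ^ u ≥ 3`. The nonadditive part therefore has low degree, and a
binomial coefficient of index `n` in a coordinate is polynomial of degree at most `n`
(`linChoose_mem`). Up to lower degree, products of such functions are differentiated like divided
powers. Reading them as dual to monomials gives a symbol `ω ^ n → k[X_i]_n` that kills `ω ^ (n +
1)`, is multiplicative (`symbol_mul`) and sends `gen i - 1` to `X_i`.

Conversely, Frobenius gives `a ^ (p ^ n) - 1 = (a - 1) ^ (p ^ n)`. Every `g` is a product of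
generators and a `p`-th power, so words in the `gen i - 1` span `ω ^ n` modulo `ω ^ (n + 1)`.
Commutators are `p ^ u`-th powers, so such words commute modulo `ω ^ (n + 1)`. Hence the symbol is
injective on each graded piece (`symbol_eq_zero_iff`).

The binomial functions separate points, which gives zero intersection; a nonzero element then has a
nonzero symbol, and these multiply in a polynomial ring, so there are no zero divisors. -/

noncomputable section

/-! ### Binomial coefficients of `p`-adic integers, reduced modulo `p` -/

section ModChoose

variable {p : ℕ} [Fact p.Prime] (k : Type*) [Field k] [CharP k p]

/-- The reduction map from the `p`-adic integers to a field of characteristic `p`. -/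
def padicRed : ℤ_[p] →+* k := (ZMod.castHom (dvd_refl p) k).comp PadicInt.toZMod

theorem padicRed_eq_zero_iff (x : ℤ_[p]) : padicRed k x = 0 ↔ (p : ℤ_[p]) ∣ x := by
  rw [padicRed, RingHom.comp_apply, map_eq_zero_iff _ (ZMod.castHom_injective k),
    ← RingHom.mem_ker, PadicInt.ker_toZMod, PadicInt.maximalIdeal_eq_span_p,
    Ideal.mem_span_singleton]

/-- The binomial coefficient `x.choose n` of a `p`-adic integer, reduced modulo `p`. -/
def modChoose (x : ℤ_[p]) (n : ℕ) : k := padicRed k (Ring.choose x n)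

@[simp] theorem modChoose_zero (x : ℤ_[p]) : modChoose k x 0 = 1 := by
  simp [modChoose]

@[simp] theorem modChoose_one (x : ℤ_[p]) : modChoose k x 1 = padicRed k x := by
  simp [modChoose]

theorem modChoose_add (x y : ℤ_[p]) (n : ℕ) : modChoose k (x + y) n =
    ∑ ij ∈ Finset.HasAntidiagonal.antidiagonal n, modChoose k x ij.1 * modChoose k y ij.2 := by
  simp [modChoose, Ring.add_choose_eq n (Commute.all x y)]

/-- Lucas' congruence for natural numbers, extended to `ℤ_[p]` by density: written as a norm bound,
the congruence is a closed condition on `x`. -/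
theorem modChoose_prime_mul (x : ℤ_[p]) (n : ℕ) :
    modChoose k ((p : ℤ_[p]) * x) n = if p ∣ n then modChoose k x (n / p) else 0 := by
  have key : ‖Ring.choose (p * x) n - (if p ∣ n then Ring.choose x (n / p) else 0)‖ ≤
      (p : ℝ) ^ (-((1 : ℕ) : ℤ)) := by
    refine PadicInt.denseRange_natCast.induction_on (p := fun x : ℤ_[p] =>
      ‖Ring.choose (p * x) n - (if p ∣ n then Ring.choose x (n / p) else 0)‖ ≤
      (p : ℝ) ^ (-((1 : ℕ) : ℤ))) x ?_ fun a => ?_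
    · refine isClosed_le ?_ continuous_const
      refine (((PadicInt.continuous_choose n).comp (continuous_const.mul continuous_id)).sub
        ?_).norm
      split_ifs
      · exact PadicInt.continuous_choose _
      · exact continuous_const
    · rw [PadicInt.norm_le_pow_iff_mem_span_pow, pow_one, Ideal.mem_span_singleton]
      have h := Choose.choose_modEq_choose_mod_mul_choose_div_nat (p := p) (n := p * a) (k := n)
      rw [Nat.mul_mod_right, Nat.mul_div_cancel_left _ (Fact.out : p.Prime).pos] at h
      have h2 : (0 : ℕ).choose (n % p) * a.choose (n / p) =
          if p ∣ n then a.choose (n / p) else 0 := by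
        split_ifs with hd
        · rw [Nat.mod_eq_zero_of_dvd hd]; simp
        · rw [Nat.choose_eq_zero_of_lt (Nat.pos_of_ne_zero fun h0 =>
            hd (Nat.dvd_of_mod_eq_zero h0)), zero_mul]
      rw [h2] at h
      have h3 := (Nat.modEq_iff_dvd.1 h.symm)
      obtain ⟨c, hc⟩ := h3
      refine ⟨(c : ℤ_[p]), ?_⟩
      have h4 := congrArg (Int.cast : ℤ → ℤ_[p]) hc
      push_cast at h4
      rw [← Nat.cast_mul, Ring.choose_natCast, Ring.choose_natCast, ← h4]
  rw [PadicInt.norm_le_pow_iff_mem_span_pow, pow_one, Ideal.mem_span_singleton,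
    ← padicRed_eq_zero_iff k, map_sub, sub_eq_zero] at key
  rw [modChoose, key]
  split_ifs <;> simp [modChoose]

theorem modChoose_prime_pow_mul (u : ℕ) (x : ℤ_[p]) (n : ℕ) :
    modChoose k ((p : ℤ_[p]) ^ u * x) n = if p ^ u ∣ n then modChoose k x (n / p ^ u) else 0 := by
  induction u generalizing n with
  | zero => simp
  | succ u ih =>
    rw [pow_succ', mul_assoc, modChoose_prime_mul]
    by_cases h : p ∣ n
    · rw [if_pos h, ih, pow_succ', ← Nat.div_div_eq_div_mul]
      exact if_congr (by rw [Nat.dvd_div_iff_mul_dvd h]) rfl rfl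
    · rw [if_neg h, if_neg fun h' => h ((Dvd.intro _ (pow_succ' p u).symm).trans h')]

/-- If `N` is the valuation of `x - y`, index `p ^ N` works: in the Vandermonde sum for `x = p ^ N *
unit + y` only the two extreme terms survive modulo `p`, and they differ from the value at `y` by a
unit. -/
theorem exists_modChoose_ne {x y : ℤ_[p]} (hxy : x ≠ y) :
    ∃ n, modChoose k x n ≠ modChoose k y n := by
  have h0 : x - y ≠ 0 := sub_ne_zero.2 hxy
  set N := (x - y).valuation
  have h1 : x = p ^ N * (PadicInt.unitCoeff h0 : ℤ_[p]) + y := by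
    rw [mul_comm, ← PadicInt.unitCoeff_spec h0, sub_add_cancel]
  refine ⟨p ^ N, fun h => ?_⟩
  have hp : 0 < p ^ N := pow_pos (Fact.out : p.Prime).pos N
  rw [h1, modChoose_add, Finset.sum_eq_add (p ^ N, 0) (0, p ^ N)] at h
  · simp only [modChoose_prime_pow_mul, dvd_refl, if_true, Nat.div_self hp, modChoose_one,
      modChoose_zero, mul_one, one_mul, add_eq_right] at h
    exact ((PadicInt.unitCoeff h0).isUnit.map (padicRed k)).ne_zero h
  · exact fun h2 => hp.ne' (congrArg Prod.fst h2)
  · rintro ⟨i, j⟩ hij ⟨h2, h3⟩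
    have h4 : ¬ p ^ N ∣ i := by
      rintro ⟨c, rfl⟩
      rw [Finset.HasAntidiagonal.mem_antidiagonal] at hij
      simp only [] at hij
      rcases c with _ | _ | c
      · exact h3 (by simpa using hij)
      · refine h2 ?_
        simp only [zero_add, mul_one] at hij ⊢
        rw [Prod.mk.injEq]; omega
      · nlinarith
    simp [modChoose_prime_pow_mul, h4]
  · simp
  · simp

end ModChoose

/-! ### Powers of the augmentation ideal -/

section AugIdeal

variable {k : Type*} [Field k] {G : Type*} [Group G]

theorem of_sub_one_mem_augIdeal (g : G) : MonoidAlgebra.of k G g - 1 ∈ augIdeal k G := by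
  simp [augIdeal, RingHom.mem_ker]

theorem sub_aug_mem_span (x : MonoidAlgebra k G) :
    x - algebraMap k _ (MonoidAlgebra.lift k k G (1 : G →* k) x) ∈
      Submodule.span k (Set.range fun g : G => MonoidAlgebra.of k G g - 1) := by
  induction x using MonoidAlgebra.induction_linear with
  | zero => simp
  | add x y hx hy =>
    rw [map_add, map_add, add_sub_add_comm]
    exact add_mem hx hy
  | single g c =>
    have h : MonoidAlgebra.single g c - algebraMap k _
        (MonoidAlgebra.lift k k G (1 : G →* k) (MonoidAlgebra.single g c)) =
        c • (MonoidAlgebra.of k G g - 1) := by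
      rw [smul_sub, Algebra.algebraMap_eq_smul_one]
      simp
    rw [h]
    exact Submodule.smul_mem _ _ (Submodule.subset_span ⟨g, rfl⟩)

theorem augIdeal_mem_span {x : MonoidAlgebra k G} (hx : x ∈ augIdeal k G) :
    x ∈ Submodule.span k (Set.range fun g : G => MonoidAlgebra.of k G g - 1) := by
  have h := sub_aug_mem_span x
  rwa [show MonoidAlgebra.lift k k G (1 : G →* k) x = 0 from hx, map_zero, sub_zero] at h

theorem smul_mem_ideal {R : Type*} [Ring R] [Algebra k R] {I : Ideal R} (c : k) {x : R}
    (hx : x ∈ I) : c • x ∈ I := by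
  rw [Algebra.smul_def]
  exact I.mul_mem_left _ hx

theorem augIdeal_pow_mul_mem {m n : ℕ} {x y : MonoidAlgebra k G} (hx : x ∈ augIdeal k G ^ m)
    (hy : y ∈ augIdeal k G ^ n) : x * y ∈ augIdeal k G ^ (m + n) := by
  rw [Ideal.IsTwoSided.pow_add]
  exact Ideal.mul_mem_mul hx hy

theorem mem_augIdeal_pow_zero (x : MonoidAlgebra k G) : x ∈ augIdeal k G ^ 0 := (powZero _ x).2

theorem augIdeal_pow_mul_sub_one_mem {n : ℕ} {x : MonoidAlgebra k G} (hx : x ∈ augIdeal k G ^ n)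
    (g : G) : x * (MonoidAlgebra.of k G g - 1) ∈ augIdeal k G ^ (n + 1) :=
  augIdeal_pow_mul_mem hx (by rw [Submodule.pow_one]; exact of_sub_one_mem_augIdeal g)

/-- Since `ω` is spanned over `k` by the `g - 1`, it suffices to treat right multiplication by `g -
1`, the operation dual to `rightDiff g`. Scalars are absorbed by the left factor. -/
theorem augIdeal_pow_succ_induction {n : ℕ} {motive : MonoidAlgebra k G → Prop}
    (add : ∀ x y, motive x → motive y → motive (x + y))
    (mul_sub_one : ∀ x ∈ augIdeal k G ^ n, ∀ g : G, motive (x * (MonoidAlgebra.of k G g - 1)))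
    {x : MonoidAlgebra k G} (hx : x ∈ augIdeal k G ^ (n + 1)) : motive x := by
  rw [Ideal.IsTwoSided.pow_add, Submodule.pow_one] at hx
  refine Submodule.mul_induction_on hx (fun a ha b hb => ?_) add
  replace hb := augIdeal_mem_span hb
  induction hb using Submodule.span_induction generalizing a with
  | mem b hb => obtain ⟨g, rfl⟩ := hb; exact mul_sub_one a ha g
  | zero =>
    have := mul_sub_one 0 (zero_mem _) 1
    rwa [zero_mul, ← mul_zero a] at this
  | add b c _ _ hb hc => rw [mul_add]; exact add _ _ (hb a ha) (hc a ha)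
  | smul c b _ hb =>
    rw [mul_smul_comm, ← smul_mul_assoc]
    exact hb _ (smul_mem_ideal c ha)

end AugIdeal

/-! ### Functions annihilated by iterated differences -/

section EvalFun

variable {k G : Type*} [Field k]

/-- The linear extension of a function on a group to its group ring. -/
def evalFun (f : G → k) : MonoidAlgebra k G →ₗ[k] k :=
  Finsupp.linearCombination k f ∘ₗ (MonoidAlgebra.coeffLinearEquiv k).toLinearMap

@[simp] theorem evalFun_single (f : G → k) (g : G) (c : k) :
    evalFun f (MonoidAlgebra.single g c) = c * f g := by
  simp [evalFun]

theorem evalFun_apply (f : G → k) (x : MonoidAlgebra k G) :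
    evalFun f x = x.coeff.sum fun g c => c * f g := by
  simp [evalFun, Finsupp.linearCombination_apply]

/-- `evalFun` as a linear map in the function. -/
def evalFunₗ (x : MonoidAlgebra k G) : (G → k) →ₗ[k] k where
  toFun f := evalFun f x
  map_add' f f' := by simp [evalFun_apply, mul_add, Finsupp.sum_add]
  map_smul' c f := by simp [evalFun_apply, Finsupp.mul_sum, mul_left_comm]

theorem evalFunₗ_apply (x : MonoidAlgebra k G) (f : G → k) : evalFunₗ x f = evalFun f x := rfl

end EvalFun

section PolyFun

variable {k : Type*} [Field k] {G : Type*} [Group G]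

/-- The right difference operator `f ↦ (h ↦ f (h * g) - f h)`. -/
def rightDiff (g : G) : (G → k) →ₗ[k] (G → k) where
  toFun f h := f (h * g) - f h
  map_add' f f' := by ext h; simp only [Pi.add_apply]; ring
  map_smul' c f := by ext h; simp only [Pi.smul_apply, smul_eq_mul, RingHom.id_apply]; ring

theorem rightDiff_apply (g : G) (f : G → k) (h : G) : rightDiff g f h = f (h * g) - f h := rfl

theorem rightDiff_mul (g : G) (f f' : G → k) : rightDiff g (f * f') =
    rightDiff g f * f' + f * rightDiff g f' + rightDiff g f * rightDiff g f' := by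
  ext h
  simp only [rightDiff_apply, Pi.add_apply, Pi.mul_apply]
  ring

variable (k G) in
/-- The functions annihilated by all `n`-fold compositions of difference operators, that is the
polynomial functions of degree less than `n`. -/
def polyFun : ℕ → Submodule k (G → k)
  | 0 => ⊥
  | n + 1 => ⨅ g : G, (polyFun n).comap (rightDiff g)

theorem mem_polyFun_succ {n : ℕ} {f : G → k} :
    f ∈ polyFun k G (n + 1) ↔ ∀ g, rightDiff g f ∈ polyFun k G n := by
  simp [polyFun]

theorem mem_polyFun_zero {f : G → k} : f ∈ polyFun k G 0 ↔ f = 0 := Submodule.mem_bot k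

theorem polyFun_mono : Monotone (polyFun k G) := by
  refine monotone_nat_of_le_succ fun n => ?_
  induction n with
  | zero => exact bot_le
  | succ n ih => exact fun f hf => mem_polyFun_succ.2 fun g => ih (mem_polyFun_succ.1 hf g)

theorem polyFun_mem_of_le {m n : ℕ} (h : m ≤ n) {f : G → k} (hf : f ∈ polyFun k G m) :
    f ∈ polyFun k G n := polyFun_mono h hf

theorem const_mem_polyFun (c : k) : (fun _ : G => c) ∈ polyFun k G 1 :=
  mem_polyFun_succ.2 fun g => mem_polyFun_zero.2 (by ext h; simp [rightDiff_apply])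

/-- Degrees add, by the twisted Leibniz rule `rightDiff_mul`. Membership in `polyFun` at index `a`
means degree below `a`, whence the shift by one. -/
theorem mul_mem_polyFun {a b n : ℕ} (hn : a + b ≤ n + 1) {f f' : G → k}
    (hf : f ∈ polyFun k G a) (hf' : f' ∈ polyFun k G b) : f * f' ∈ polyFun k G n := by
  induction n generalizing a b f f' with
  | zero =>
    rcases (by omega : a = 0 ∨ b = 0) with rfl | rfl
    · rw [mem_polyFun_zero.1 hf, zero_mul]; exact zero_mem _
    · rw [mem_polyFun_zero.1 hf', mul_zero]; exact zero_mem _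
  | succ n ih =>
    rcases a with _ | a
    · rw [mem_polyFun_zero.1 hf, zero_mul]; exact zero_mem _
    rcases b with _ | b
    · rw [mem_polyFun_zero.1 hf', mul_zero]; exact zero_mem _
    refine mem_polyFun_succ.2 fun g => ?_
    have h1 := mem_polyFun_succ.1 hf g
    have h2 := mem_polyFun_succ.1 hf' g
    rw [rightDiff_mul]
    exact add_mem (add_mem (ih (by omega) h1 hf') (ih (by omega) hf h2)) (ih (by omega) h1 h2)

variable (k G) in
/-- The polynomial functions of arbitrary degree. -/
def polyFunAlgebra : Subalgebra k (G → k) where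
  carrier := {f | ∃ n, f ∈ polyFun k G n}
  mul_mem' := fun ⟨a, ha⟩ ⟨b, hb⟩ => ⟨a + b, mul_mem_polyFun (Nat.le_succ _) ha hb⟩
  add_mem' := fun ⟨a, ha⟩ ⟨b, hb⟩ => ⟨a + b, add_mem (polyFun_mem_of_le (by omega) ha)
    (polyFun_mem_of_le (by omega) hb)⟩
  algebraMap_mem' c := ⟨1, const_mem_polyFun c⟩

theorem evalFun_one_eq (x : MonoidAlgebra k G) :
    evalFun (fun _ => 1) x = MonoidAlgebra.lift k k G (1 : G →* k) x := by
  simp [evalFun_apply, MonoidAlgebra.lift_apply]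

theorem evalFun_mul_sub_one (f : G → k) (x : MonoidAlgebra k G) (g : G) :
    evalFun f (x * (MonoidAlgebra.of k G g - 1)) = evalFun (rightDiff g f) x := by
  induction x using MonoidAlgebra.induction_linear with
  | zero => simp
  | add x y hx hy => rw [add_mul, map_add, map_add, hx, hy]
  | single h c =>
    rw [mul_sub, mul_one, map_sub, MonoidAlgebra.of_apply, MonoidAlgebra.single_mul_single]
    simp [rightDiff_apply, mul_sub]

/-- Each factor `g - 1` of `x` costs `f` one difference. -/
theorem evalFun_eq_zero {n : ℕ} {f : G → k} (hf : f ∈ polyFun k G n) {x : MonoidAlgebra k G}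
    (hx : x ∈ augIdeal k G ^ n) : evalFun f x = 0 := by
  induction n generalizing f x with
  | zero =>
    rw [mem_polyFun_zero.1 hf, evalFun_apply]
    simp
  | succ n ih =>
    refine augIdeal_pow_succ_induction (motive := fun x => evalFun f x = 0) (fun x y hx hy => ?_)
      (fun x hx g => ?_) hx
    · rw [map_add, hx, hy, add_zero]
    · rw [evalFun_mul_sub_one]
      exact ih (mem_polyFun_succ.1 hf g) hx

/-- If the polynomial functions separate the points of `G`, then the powers of the augmentation
ideal have zero intersection. -/
theorem iInf_augIdeal_pow_eq_bot
    (hsep : ∀ g h : G, g ≠ h → ∃ f ∈ polyFunAlgebra k G, f g ≠ f h) :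
    ⨅ n : ℕ, augIdeal k G ^ n = ⊥ := by
  classical
  rw [eq_bot_iff]
  intro x hx
  rw [Ideal.mem_bot]
  by_contra hne
  rw [← MonoidAlgebra.coeff_eq_zero, ← ne_eq, ← Finsupp.support_nonempty_iff] at hne
  obtain ⟨g, hg⟩ := hne
  have hsep' : ∀ h : G, h ≠ g → ∃ f ∈ polyFunAlgebra k G, f g = 1 ∧ f h = 0 := fun h hh => by
    obtain ⟨f, hf, hne⟩ := hsep g h hh.symm
    refine ⟨(f g - f h)⁻¹ • (f - algebraMap k _ (f h)), Subalgebra.smul_mem _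
      (sub_mem hf (Subalgebra.algebraMap_mem _ _)) _, ?_, ?_⟩
    · simpa using inv_mul_cancel₀ (sub_ne_zero.2 hne)
    · simp
  choose! F hF hF1 hF0 using hsep'
  -- This product is `1` at `g` and `0` elsewhere on the support, so pairing it with `x` returns the
  -- coefficient of `g`.
  have hP : ∏ h ∈ x.coeff.support.erase g, F h ∈ polyFunAlgebra k G :=
    prod_mem fun h hh => hF h (Finset.ne_of_mem_erase hh)
  obtain ⟨n, hn⟩ := hP
  have h0 := evalFun_eq_zero hn ((Submodule.mem_iInf _).1 hx n)
  rw [evalFun_apply, Finsupp.sum, Finset.sum_eq_single_of_mem g hg, Finset.prod_apply,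
    Finset.prod_eq_one fun h hh => hF1 h (Finset.ne_of_mem_erase hh), mul_one] at h0
  · exact Finsupp.mem_support_iff.1 hg h0
  · intro h hh hne
    rw [Finset.prod_apply, Finset.prod_eq_zero (Finset.mem_erase.2 ⟨hne, hh⟩)
      (f := fun c => F c h) (hF0 h hne), mul_zero]

end PolyFun

/-! ### Groups with `p`-adic coordinates -/

/-- Coordinates on a group `G` with values in `ℤ_[p]`, in which the group law is additive up to
terms divisible by `p ^ depth ≥ 3` that are linear in the left factor, and such that elements with
coordinates divisible by `p` are `p`-th powers and commutators are `p ^ depth`-th powers. -/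
structure UniformCoords (p : ℕ) [Fact p.Prime] (ι : Type*) [Fintype ι] [DecidableEq ι]
    (G : Type*) [Group G] where
  /-- The coordinates of an element. -/
  coord : G → ι → ℤ_[p]
  /-- The exponent of the power of `p` that divides the nonadditive part of the group law. -/
  depth : ℕ
  three_le : 3 ≤ p ^ depth
  -- Differencing by `g` turns the linear form `c` into a new one `c'`, so the induction on degree
  -- must cover all forms at once.
  exists_dotProduct_mul : ∀ (c : ι → ℤ_[p]) (g : G), ∃ c' : ι → ℤ_[p], ∀ h : G,
    c ⬝ᵥ coord (h * g) = c ⬝ᵥ coord g + (p : ℤ_[p]) ^ depth * (c' ⬝ᵥ coord h) + c ⬝ᵥ coord h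
  coord_injective : Function.Injective coord
  /-- The elements whose coordinates are the standard basis vectors. -/
  gen : ι → G
  coord_gen : ∀ i, coord (gen i) = Pi.single i 1
  exists_pow_eq : ∀ g, (∀ i, (p : ℤ_[p]) ∣ coord g i) → ∃ h, h ^ p = g
  exists_pow_eq_commutator : ∀ g h : G, ∃ a, a ^ p ^ depth = g * h * g⁻¹ * h⁻¹

namespace UniformCoords

variable {p : ℕ} [Fact p.Prime] {ι : Type*} [Fintype ι] [DecidableEq ι] {G : Type*} [Group G]
  (U : UniformCoords p ι G) (k : Type*) [Field k] [CharP k p]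

/-- The function `h ↦ (c ⬝ᵥ coord h).choose n`, modulo `p`. -/
def linChoose (c : ι → ℤ_[p]) (n : ℕ) : G → k := fun h => modChoose k (c ⬝ᵥ U.coord h) n

/-- The function `h ↦ (x + p ^ depth * (c ⬝ᵥ coord h)).choose n`, modulo `p`. -/
def shiftChoose (x : ℤ_[p]) (c : ι → ℤ_[p]) (n : ℕ) : G → k :=
  fun h => modChoose k (x + (p : ℤ_[p]) ^ U.depth * (c ⬝ᵥ U.coord h)) n

theorem linChoose_zero (c : ι → ℤ_[p]) : U.linChoose k c 0 = 1 := by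
  ext h; simp [linChoose]

theorem rightDiff_linChoose_zero (c : ι → ℤ_[p]) (g : G) :
    rightDiff g (U.linChoose k c 0) = 0 := by
  ext h; simp [linChoose, rightDiff_apply]

/-- Vandermonde; the term with index `0` in the shift is `linChoose` itself and cancels in the
difference. -/
theorem exists_rightDiff_linChoose (c : ι → ℤ_[p]) (g : G) : ∃ c' : ι → ℤ_[p], ∀ n,
    rightDiff g (U.linChoose k c (n + 1)) =
      ∑ ij ∈ Finset.HasAntidiagonal.antidiagonal n,
        U.shiftChoose k (c ⬝ᵥ U.coord g) c' (ij.1 + 1) * U.linChoose k c ij.2 := by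
  obtain ⟨c', hc'⟩ := U.exists_dotProduct_mul c g
  refine ⟨c', fun n => ?_⟩
  ext h
  simp only [rightDiff_apply, linChoose, hc', Finset.sum_apply, Pi.mul_apply, shiftChoose]
  rw [modChoose_add k _ (c ⬝ᵥ U.coord h), Finset.Nat.antidiagonal_succ]
  simp

theorem shiftChoose_eq (x : ℤ_[p]) (c : ι → ℤ_[p]) (n : ℕ) : U.shiftChoose k x c n =
    ∑ ij ∈ Finset.HasAntidiagonal.antidiagonal n, modChoose k x ij.1 •
      (if p ^ U.depth ∣ ij.2 then U.linChoose k c (ij.2 / p ^ U.depth) else 0) := by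
  ext h
  simp only [shiftChoose, modChoose_add, Finset.sum_apply, modChoose_prime_pow_mul]
  refine Finset.sum_congr rfl fun ij _ => ?_
  split_ifs <;> simp [linChoose]

theorem padicRed_pow_depth : padicRed k ((p : ℤ_[p]) ^ U.depth) = 0 := by
  rw [padicRed_eq_zero_iff]
  refine dvd_pow_self _ fun h => ?_
  have := U.three_le
  simp [h] at this

theorem shiftChoose_one (x : ℤ_[p]) (c : ι → ℤ_[p]) :
    U.shiftChoose k x c 1 = fun _ => padicRed k x := by
  ext g
  simp [shiftChoose, U.padicRed_pow_depth]

theorem padicRed_coord_mul (h g : G) (i : ι) : padicRed k (U.coord (h * g) i) =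
    padicRed k (U.coord h i) + padicRed k (U.coord g i) := by
  obtain ⟨c', hc'⟩ := U.exists_dotProduct_mul (Pi.single i 1) g
  have h1 := congrArg (padicRed k) (hc' h)
  simpa [U.padicRed_pow_depth, add_comm] using h1

theorem padicRed_coord_one (i : ι) : padicRed k (U.coord 1 i) = 0 := by
  have h := U.padicRed_coord_mul k 1 1 i
  rw [mul_one] at h
  exact left_eq_add.1 h

theorem padicRed_coord_pow (g : G) (n : ℕ) (i : ι) :
    padicRed k (U.coord (g ^ n) i) = n * padicRed k (U.coord g i) := by
  induction n with
  | zero => simp [padicRed_coord_one]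
  | succ n ih => rw [pow_succ, padicRed_coord_mul, ih]; push_cast; ring

/-- Lucas divides the index by `p ^ depth ≥ 3`, so the degree is at most `n / 3`. -/
theorem shiftChoose_mem {n m : ℕ} (hn : n / 3 + 1 ≤ m) (x : ℤ_[p]) (c : ι → ℤ_[p])
    (H : ∀ j ≤ n / 3, U.linChoose k c j ∈ polyFun k G (j + 1)) :
    U.shiftChoose k x c n ∈ polyFun k G m := by
  rw [shiftChoose_eq]
  refine sum_mem fun ij hij => Submodule.smul_mem _ _ ?_
  rw [Finset.HasAntidiagonal.mem_antidiagonal] at hij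
  split_ifs
  · have h1 : ij.2 / p ^ U.depth ≤ n / 3 :=
      (Nat.div_le_div_left U.three_le (by norm_num)).trans (Nat.div_le_div_right (by omega))
    exact polyFun_mem_of_le (by omega) (H _ h1)
  · exact zero_mem _

theorem linChoose_mem (c : ι → ℤ_[p]) (n : ℕ) : U.linChoose k c n ∈ polyFun k G (n + 1) := by
  induction n using Nat.strong_induction_on generalizing c with
  | _ n ih =>
    rcases n with _ | n
    · rw [linChoose_zero]
      exact const_mem_polyFun 1
    refine mem_polyFun_succ.2 fun g => ?_
    obtain ⟨c', hc'⟩ := U.exists_rightDiff_linChoose k c g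
    rw [hc']
    refine sum_mem fun ij hij => ?_
    rw [Finset.HasAntidiagonal.mem_antidiagonal] at hij
    exact mul_mem_polyFun (a := ij.1 + 1) (b := ij.2 + 1) (by omega)
      (U.shiftChoose_mem k (by omega) _ _ fun j hj => ih j (by omega) c') (ih _ (by omega) c)

/-- Only the shift term of index `1`, a constant, reaches the top degree. Index `m ≥ 2` gives degree
at most `m / 3 ≤ m - 2`; at `m = 2` this needs `p ^ depth ≥ 3`, not just `2`. -/
theorem rightDiff_linChoose_succ_sub_mem (c : ι → ℤ_[p]) (n : ℕ) (g : G) :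
    rightDiff g (U.linChoose k c (n + 1)) - padicRed k (c ⬝ᵥ U.coord g) • U.linChoose k c n ∈
      polyFun k G n := by
  obtain ⟨c', hc'⟩ := U.exists_rightDiff_linChoose k c g
  rw [hc']
  rcases n with _ | n
  · rw [Finset.Nat.antidiagonal_zero, Finset.sum_singleton, shiftChoose_one]
    convert zero_mem (polyFun k G 0) using 1
    rw [sub_eq_zero]
    rfl
  · rw [Finset.Nat.antidiagonal_succ, Finset.sum_cons]
    simp only [zero_add]
    rw [shiftChoose_one, show ((fun _ => padicRed k (c ⬝ᵥ U.coord g)) * U.linChoose k c (n + 1) :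
      G → k) = padicRed k (c ⬝ᵥ U.coord g) • U.linChoose k c (n + 1) from rfl,
      add_sub_cancel_left, Finset.sum_map]
    refine sum_mem fun ij hij => ?_
    rw [Finset.HasAntidiagonal.mem_antidiagonal] at hij
    refine mul_mem_polyFun (a := ij.1 + 1) (b := ij.2 + 1) (by omega) ?_ (U.linChoose_mem k c _)
    exact U.shiftChoose_mem k (by simp; omega) _ _ fun j _ => U.linChoose_mem k _ _

end UniformCoords

/-! ### Leading terms of differences -/

section LeadingDiff

variable {k : Type*} [Field k] {G : Type*} [Group G]

/-- `f` is a polynomial function of degree at most `n`, and `f'` is the leading part, of degree at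
most `n - 1`, of its difference by `g`. -/
structure IsLeadingDiff (g : G) (n : ℕ) (f f' : G → k) : Prop where
  mem : f ∈ polyFun k G (n + 1)
  lead_mem : f' ∈ polyFun k G n
  sub_mem : rightDiff g f - f' ∈ polyFun k G (n - 1)

theorem IsLeadingDiff.one (g : G) : IsLeadingDiff g 0 (1 : G → k) 0 where
  mem := const_mem_polyFun 1
  lead_mem := zero_mem _
  sub_mem := by
    convert zero_mem (polyFun k G (0 - 1)) using 1
    ext h
    simp [rightDiff_apply]

theorem sub_mul_mem_polyFun {a b : ℕ} {f f' : G → k} (hf : f ∈ polyFun k G (a - 1))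
    (hf' : f' ∈ polyFun k G (b + 1)) : f * f' ∈ polyFun k G (a + b - 1) := by
  rcases a with _ | a
  · rw [mem_polyFun_zero.1 hf, zero_mul]
    exact zero_mem _
  · exact mul_mem_polyFun (a := a) (b := b + 1) (by omega) hf hf'

/-- The product of the two differences loses two degrees, so leading parts obey the ordinary Leibniz
rule. -/
theorem IsLeadingDiff.mul {g : G} {m n : ℕ} {f f' e e' : G → k} (hf : IsLeadingDiff g m f f')
    (he : IsLeadingDiff g n e e') : IsLeadingDiff g (m + n) (f * e) (f' * e + f * e') where
  mem := mul_mem_polyFun (by omega) hf.mem he.mem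
  lead_mem := add_mem (mul_mem_polyFun (by omega) hf.lead_mem he.mem)
    (mul_mem_polyFun (by omega) hf.mem he.lead_mem)
  sub_mem := by
    have h : rightDiff g (f * e) - (f' * e + f * e') =
        (rightDiff g f - f') * e + (rightDiff g e - e') * f + rightDiff g f * rightDiff g e := by
      rw [rightDiff_mul]; ring
    rw [h]
    refine add_mem (add_mem (sub_mul_mem_polyFun hf.sub_mem he.mem) ?_) ?_
    · rw [add_comm m n]
      exact sub_mul_mem_polyFun he.sub_mem hf.mem
    · exact mul_mem_polyFun (a := m) (b := n) (by omega) (mem_polyFun_succ.1 hf.mem g)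
        (mem_polyFun_succ.1 he.mem g)

theorem IsLeadingDiff.prod {ι : Type*} [DecidableEq ι] {g : G} (s : Finset ι) {n : ι → ℕ}
    {f f' : ι → G → k} (hf : ∀ i, IsLeadingDiff g (n i) (f i) (f' i)) :
    IsLeadingDiff g (∑ i ∈ s, n i) (∏ i ∈ s, f i)
      (∑ i ∈ s, f' i * ∏ j ∈ s.erase i, f j) := by
  induction s using Finset.induction_on with
  | empty => exact .one g
  | insert i s hi ih =>
    rw [Finset.sum_insert hi, Finset.prod_insert hi, Finset.sum_insert hi, Finset.erase_insert hi]
    convert (hf i).mul ih using 2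
    rw [Finset.mul_sum]
    refine Finset.sum_congr rfl fun j hj => ?_
    rw [Finset.erase_insert_of_ne (by rintro rfl; exact hi hj), Finset.prod_insert (by simp [hi])]
    ring

end LeadingDiff

/-! ### The symbol map -/

namespace UniformCoords

variable {p : ℕ} [Fact p.Prime] {ι : Type*} [Fintype ι] [DecidableEq ι] {G : Type*} [Group G]
  (U : UniformCoords p ι G) (k : Type*) [Field k] [CharP k p]

/-- The product of the binomial coefficients of the coordinates, modulo `p`. -/
def monoFun (α : ι →₀ ℕ) : G → k := ∏ i, U.linChoose k (Pi.single i 1) (α i)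

theorem isLeadingDiff_linChoose (i : ι) (n : ℕ) (g : G) :
    IsLeadingDiff g n (U.linChoose k (Pi.single i 1) n)
      (if n = 0 then 0 else padicRed k (U.coord g i) • U.linChoose k (Pi.single i 1) (n - 1)) where
  mem := U.linChoose_mem k _ n
  lead_mem := by
    split_ifs with h
    · exact zero_mem _
    · exact Submodule.smul_mem _ _ (polyFun_mem_of_le (by omega) (U.linChoose_mem k _ _))
  sub_mem := by
    rcases n with _ | n
    · simp [rightDiff_linChoose_zero]
    · simpa using U.rightDiff_linChoose_succ_sub_mem k (Pi.single i 1) n g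

theorem linChoose_mul_prod_erase (i : ι) (α : ι →₀ ℕ) :
    U.linChoose k (Pi.single i 1) (α i - 1) *
      ∏ j ∈ Finset.univ.erase i, U.linChoose k (Pi.single j 1) (α j) =
    U.monoFun k (α - Finsupp.single i 1) := by
  rw [monoFun, ← Finset.mul_prod_erase _ _ (Finset.mem_univ i)]
  congr 1
  · simp
  · refine Finset.prod_congr rfl fun j hj => ?_
    rw [Finsupp.tsub_apply, Finsupp.single_eq_of_ne (Finset.ne_of_mem_erase hj), tsub_zero]

/-- No factor `α i` appears, as for divided powers: this is the transpose of multiplication by the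
linear form with coefficients `coord g` modulo `p`. -/
theorem isLeadingDiff_monoFun (α : ι →₀ ℕ) (g : G) : IsLeadingDiff g α.degree (U.monoFun k α)
    (∑ i, if α i = 0 then 0 else
      padicRed k (U.coord g i) • U.monoFun k (α - Finsupp.single i 1)) := by
  have h := IsLeadingDiff.prod Finset.univ fun i => U.isLeadingDiff_linChoose k i (α i) g
  rw [← Finsupp.degree_eq_sum] at h
  rw [Finset.sum_congr rfl fun i _ => ?_] at h
  · exact h
  · split_ifs
    · rw [zero_mul]
    · rw [smul_mul_assoc, linChoose_mul_prod_erase U k i α]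

theorem evalFun_monoFun_mul_sub_one {n : ℕ} {α : ι →₀ ℕ} (hα : α.degree = n + 1)
    {x : MonoidAlgebra k G} (hx : x ∈ augIdeal k G ^ n) (g : G) :
    evalFun (U.monoFun k α) (x * (MonoidAlgebra.of k G g - 1)) = ∑ i, if α i = 0 then 0 else
      padicRed k (U.coord g i) * evalFun (U.monoFun k (α - Finsupp.single i 1)) x := by
  have h := (U.isLeadingDiff_monoFun k α g).sub_mem
  rw [hα, Nat.add_sub_cancel] at h
  have h0 := evalFun_eq_zero h hx
  rw [← evalFunₗ_apply, map_sub, sub_eq_zero] at h0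
  rw [evalFun_mul_sub_one, ← evalFunₗ_apply, h0, map_sum]
  refine Finset.sum_congr rfl fun i _ => ?_
  split_ifs
  · rw [map_zero]
  · rw [map_smul, evalFunₗ_apply, smul_eq_mul]

/-- The symbol of degree `n` of an element of the group ring; it is meaningful on the `n`-th power
of the augmentation ideal. -/
def symbol (n : ℕ) : MonoidAlgebra k G →ₗ[k] MvPolynomial ι k :=
  ∑ α ∈ Finset.finsuppAntidiag Finset.univ n,
    MvPolynomial.monomial α ∘ₗ evalFun (U.monoFun k α)

variable {k}

theorem coeff_symbol (n : ℕ) (x : MonoidAlgebra k G) (α : ι →₀ ℕ) :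
    (U.symbol k n x).coeff α = if α.degree = n then evalFun (U.monoFun k α) x else 0 := by
  have h : α ∈ Finset.finsuppAntidiag Finset.univ n ↔ α.degree = n := by
    simp [Finset.mem_finsuppAntidiag, Finsupp.degree_eq_sum]
  simp only [symbol, LinearMap.sum_apply, LinearMap.comp_apply, MvPolynomial.coeff_sum,
    MvPolynomial.coeff_monomial, Finset.sum_ite_eq', h]

theorem isHomogeneous_symbol (n : ℕ) (x : MonoidAlgebra k G) :
    (U.symbol k n x).IsHomogeneous n := by
  intro α hα
  rw [coeff_symbol] at hα
  by_contra h
  change Finsupp.weight (fun _ => 1) α ≠ n at h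
  rw [← Finsupp.degree_eq_weight_one] at h
  exact hα (if_neg h)

theorem symbol_eq_zero {n : ℕ} {x : MonoidAlgebra k G} (hx : x ∈ augIdeal k G ^ (n + 1)) :
    U.symbol k n x = 0 := by
  ext α
  rw [coeff_symbol, MvPolynomial.coeff_zero]
  split_ifs with h
  · exact evalFun_eq_zero (h ▸ (U.isLeadingDiff_monoFun k α 1).mem) hx
  · rfl

theorem symbol_mul_sub_one {n : ℕ} {x : MonoidAlgebra k G} (hx : x ∈ augIdeal k G ^ n) (g : G) :
    U.symbol k (n + 1) (x * (MonoidAlgebra.of k G g - 1)) =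
      U.symbol k n x * ∑ i, padicRed k (U.coord g i) • MvPolynomial.X i := by
  ext α
  rw [coeff_symbol, Finset.mul_sum, MvPolynomial.coeff_sum]
  simp only [mul_smul_comm, MvPolynomial.coeff_smul, MvPolynomial.coeff_mul_X', coeff_symbol,
    Finsupp.mem_support_iff, smul_eq_mul]
  have hdeg : ∀ i, α i ≠ 0 → (α - Finsupp.single i 1).degree + 1 = α.degree := fun i hi => by
    have h1 : α - Finsupp.single i 1 + Finsupp.single i 1 = α :=
      tsub_add_cancel_of_le (Finsupp.single_le_iff.2 (Nat.one_le_iff_ne_zero.2 hi))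
    rw [← congrArg Finsupp.degree h1, map_add, Finsupp.degree_single]
  split_ifs with h
  · rw [U.evalFun_monoFun_mul_sub_one k h hx]
    refine Finset.sum_congr rfl fun i _ => ?_
    by_cases hi : α i = 0
    · simp [hi]
    · have := hdeg i hi
      rw [if_neg hi, if_pos hi, if_pos (by omega)]
  · refine (Finset.sum_eq_zero fun i _ => ?_).symm
    by_cases hi : α i = 0
    · simp [hi]
    · have := hdeg i hi
      rw [if_pos hi, if_neg (by omega), mul_zero]

theorem symbol_zero (x : MonoidAlgebra k G) :
    U.symbol k 0 x = MvPolynomial.C (MonoidAlgebra.lift k k G (1 : G →* k) x) := by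
  ext α
  rw [coeff_symbol, MvPolynomial.coeff_C]
  by_cases h : α = 0
  · subst h
    rw [if_pos (map_zero _), if_pos rfl, ← evalFun_one_eq]
    congr 1
    ext g
    simp [monoFun, linChoose]
  · rw [if_neg (Ne.symm h), if_neg (mt (Finsupp.degree_eq_zero_iff α).1 h)]

theorem symbol_one : U.symbol k 0 (1 : MonoidAlgebra k G) = 1 := by
  rw [symbol_zero, map_one, map_one]

/-- Right multiplication by `g - 1` multiplies symbols by a linear form, which gives the induction
on `n`. For `n = 0`, `y` is a constant modulo `ω`. -/
theorem symbol_mul {m n : ℕ} {x y : MonoidAlgebra k G} (hx : x ∈ augIdeal k G ^ m)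
    (hy : y ∈ augIdeal k G ^ n) :
    U.symbol k (m + n) (x * y) = U.symbol k m x * U.symbol k n y := by
  induction n generalizing y with
  | zero =>
    set c := MonoidAlgebra.lift k k G (1 : G →* k) y with hc
    have h1 : y - algebraMap k _ c ∈ augIdeal k G ^ 1 := by
      rw [Submodule.pow_one, augIdeal, RingHom.mem_ker, map_sub, AlgHom.commutes]
      exact sub_self c
    have h2 := U.symbol_eq_zero (augIdeal_pow_mul_mem hx h1)
    rw [mul_sub, map_sub, sub_eq_zero, ← Algebra.commutes, ← Algebra.smul_def, map_smul] at h2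
    rw [symbol_zero, add_zero, h2, ← hc, mul_comm, MvPolynomial.C_mul']
  | succ n ih =>
    refine augIdeal_pow_succ_induction (motive := fun y =>
      U.symbol k (m + (n + 1)) (x * y) = U.symbol k m x * U.symbol k (n + 1) y)
      (fun y y' h h' => ?_) (fun y hy g => ?_) hy
    · rw [mul_add, map_add, h, h', map_add, mul_add]
    · rw [← mul_assoc, ← add_assoc, symbol_mul_sub_one U (augIdeal_pow_mul_mem hx hy), ih hy,
        symbol_mul_sub_one U hy, mul_assoc]

theorem symbol_gen (i : ι) :
    U.symbol k 1 (MonoidAlgebra.of k G (U.gen i) - 1) = MvPolynomial.X i := by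
  have h := U.symbol_mul_sub_one (mem_augIdeal_pow_zero (1 : MonoidAlgebra k G)) (U.gen i)
  rw [one_mul, zero_add, symbol_one, one_mul, coord_gen, Finset.sum_eq_single i] at h
  · simpa using h
  · intro j _ hj
    simp [hj]
  · simp

end UniformCoords

/-! ### Injectivity of the symbol map -/

theorem augIdeal_pow_antitone {k G : Type*} [Field k] [Group G] {m n : ℕ} (h : m ≤ n) :
    augIdeal k G ^ n ≤ augIdeal k G ^ m := by
  obtain ⟨r, rfl⟩ := Nat.exists_eq_add_of_le h
  rw [add_comm, Ideal.IsTwoSided.pow_add]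
  exact Ideal.mul_le_right

theorem sub_one_mem_augIdeal_pow {k G : Type*} [Field k] [Group G] {p : ℕ} [Fact p.Prime]
    [CharP k p] (a : G) (n : ℕ) : MonoidAlgebra.of k G (a ^ p ^ n) - 1 ∈ augIdeal k G ^ p ^ n := by
  have : CharP (MonoidAlgebra k G) p :=
    charP_of_injective_algebraMap (FaithfulSMul.algebraMap_injective k _) p
  have h := sub_pow_char_pow_of_commute (p := p) (n := n)
    (Commute.one_right (MonoidAlgebra.of k G a))
  rw [one_pow, ← map_pow] at h
  rw [← h]
  exact Ideal.pow_mem_pow (of_sub_one_mem_augIdeal a) _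

namespace UniformCoords

variable {p : ℕ} [Fact p.Prime] {ι : Type*} [Fintype ι] [DecidableEq ι] {G : Type*} [Group G]
  (U : UniformCoords p ι G) (k : Type*) [Field k]

/-- The element `gen i - 1` of the group ring. -/
def genSub (i : ι) : MonoidAlgebra k G := MonoidAlgebra.of k G (U.gen i) - 1

/-- The span of the elements `gen i - 1`. -/
def genSpan : Submodule k (MonoidAlgebra k G) := Submodule.span k (Set.range (U.genSub k))

/-- The subgroup of the elements `g` such that `g - 1` lies in the span of the elements
`gen i - 1`, modulo the square of the augmentation ideal. -/
def genSubgroup : Subgroup G where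
  carrier := {g | ∃ z ∈ U.genSpan k, MonoidAlgebra.of k G g - 1 - z ∈ augIdeal k G ^ 2}
  one_mem' := ⟨0, zero_mem _, by rw [map_one, sub_self, sub_zero]; exact zero_mem _⟩
  mul_mem' := by
    rintro g h ⟨z, hz, hgz⟩ ⟨z', hz', hgz'⟩
    refine ⟨z + z', add_mem hz hz', ?_⟩
    have h1 : MonoidAlgebra.of k G (g * h) - 1 - (z + z') =
        (MonoidAlgebra.of k G g - 1 - z) + (MonoidAlgebra.of k G h - 1 - z') +
          (MonoidAlgebra.of k G g - 1) * (MonoidAlgebra.of k G h - 1) := by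
      rw [map_mul]; noncomm_ring
    rw [h1]
    refine add_mem (add_mem hgz hgz') (augIdeal_pow_mul_sub_one_mem ?_ h)
    rw [Submodule.pow_one]
    exact of_sub_one_mem_augIdeal g
  inv_mem' := by
    rintro g ⟨z, hz, hgz⟩
    refine ⟨-z, neg_mem hz, ?_⟩
    have h0 : MonoidAlgebra.of k G g * MonoidAlgebra.of k G g⁻¹ = 1 := by
      rw [← map_mul, mul_inv_cancel, map_one]
    have h1 : MonoidAlgebra.of k G g⁻¹ - 1 - -z = -(MonoidAlgebra.of k G g - 1 - z) -
          (MonoidAlgebra.of k G g - 1) * (MonoidAlgebra.of k G g⁻¹ - 1) := by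
      rw [sub_mul, mul_sub, h0]; noncomm_ring
    rw [h1]
    refine sub_mem (neg_mem hgz) (augIdeal_pow_mul_sub_one_mem ?_ _)
    rw [Submodule.pow_one]
    exact of_sub_one_mem_augIdeal g

theorem gen_mem_genSubgroup (i : ι) : U.gen i ∈ U.genSubgroup k :=
  ⟨U.genSub k i, Submodule.subset_span ⟨i, rfl⟩, by rw [genSub, sub_self]; exact zero_mem _⟩

/-- The product of the elements `gen i - 1`, over the entries `i` of a list. -/
def listProd (w : List ι) : MonoidAlgebra k G := (w.map (U.genSub k)).prod

theorem genSub_mem (i : ι) : U.genSub k i ∈ augIdeal k G ^ 1 := by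
  rw [Submodule.pow_one]
  exact of_sub_one_mem_augIdeal _

theorem listProd_mem (w : List ι) : U.listProd k w ∈ augIdeal k G ^ w.length := by
  induction w with
  | nil => exact mem_augIdeal_pow_zero _
  | cons i w ih =>
    rw [listProd, List.map_cons, List.prod_cons, List.length_cons, add_comm]
    exact augIdeal_pow_mul_mem (U.genSub_mem k i) ih

/-- The span of the products of `n` elements `gen i - 1`. -/
def listSpan (n : ℕ) : Submodule k (MonoidAlgebra k G) :=
  Submodule.span k {x | ∃ w : List ι, w.length = n ∧ U.listProd k w = x}

theorem listSpan_le {n : ℕ} {x : MonoidAlgebra k G} (hx : x ∈ U.listSpan k n) :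
    x ∈ augIdeal k G ^ n := by
  induction hx using Submodule.span_induction with
  | mem x hx => obtain ⟨w, rfl, rfl⟩ := hx; exact U.listProd_mem k w
  | zero => exact zero_mem _
  | add x y _ _ hx hy => exact add_mem hx hy
  | smul c x _ hx => exact smul_mem_ideal c hx

theorem listSpan_mul_genSpan {n : ℕ} {x z : MonoidAlgebra k G} (hx : x ∈ U.listSpan k n)
    (hz : z ∈ U.genSpan k) : x * z ∈ U.listSpan k (n + 1) := by
  refine (Submodule.mul_le (P := U.listSpan k (n + 1))).1 ?_ x hx z hz
  rw [listSpan, genSpan, Submodule.span_mul_span, Submodule.span_le]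
  rintro _ ⟨_, ⟨w, rfl, rfl⟩, _, ⟨i, rfl⟩, rfl⟩
  exact Submodule.subset_span ⟨w ++ [i], by simp, by simp [listProd]⟩

/-- A linear section of the symbol map. -/
def symbolSection : MvPolynomial ι k →ₗ[k] MonoidAlgebra k G :=
  (MvPolynomial.basisMonomials ι k).constr k fun α => U.listProd k (Finsupp.toMultiset α).toList

theorem symbolSection_prod_X (w : List ι) : U.symbolSection k (w.map MvPolynomial.X).prod =
    U.listProd k (w : Multiset ι).toList := by
  have h : (w.map (MvPolynomial.X : ι → MvPolynomial ι k)).prod =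
      MvPolynomial.basisMonomials ι k (Multiset.toFinsupp (w : Multiset ι)) := by
    rw [MvPolynomial.coe_basisMonomials]
    induction w with
    | nil => simp [MvPolynomial.monomial_zero']
    | cons i w ih =>
      rw [List.map_cons, List.prod_cons, ih, MvPolynomial.X, MvPolynomial.monomial_mul, mul_one,
        ← Multiset.cons_coe, ← Multiset.singleton_add, map_add, Multiset.toFinsupp_singleton]
  rw [h, symbolSection, Module.Basis.constr_basis, Multiset.toFinsupp_toMultiset]

theorem exists_mem_genSubgroup (v : ι → ZMod p) :
    ∃ s ∈ U.genSubgroup k, ∀ i, padicRed (ZMod p) (U.coord s i) = v i := by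
  rw [← Finset.univ_sum_single v]
  refine Finset.sum_induction _ (fun v : ι → ZMod p => ∃ s ∈ U.genSubgroup k,
    ∀ i, padicRed (ZMod p) (U.coord s i) = v i) ?_ ?_ fun i _ => ?_
  · rintro v w ⟨s, hs, hv⟩ ⟨t, ht, hw⟩
    exact ⟨s * t, mul_mem hs ht, fun i => by rw [padicRed_coord_mul, hv, hw, Pi.add_apply]⟩
  · exact ⟨1, one_mem _, fun i => U.padicRed_coord_one _ i⟩
  · refine ⟨U.gen i ^ (v i).val, pow_mem (U.gen_mem_genSubgroup k i) _, fun j => ?_⟩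
    rw [padicRed_coord_pow, coord_gen]
    by_cases h : j = i
    · subst h; simp
    · simp [h]

variable [CharP k p]

theorem pow_mem_genSubgroup (g : G) : g ^ p ∈ U.genSubgroup k := by
  refine ⟨0, zero_mem _, ?_⟩
  have h := sub_one_mem_augIdeal_pow (k := k) (p := p) g 1
  rw [pow_one] at h
  rw [sub_zero]
  exact augIdeal_pow_antitone (Fact.out : p.Prime).two_le h

/-- Dividing `g` by a product of generators with the same coordinates modulo `p` leaves a `p`-th
power `a ^ p`, and `a ^ p - 1 = (a - 1) ^ p` lies in `ω ^ 2`. -/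
theorem genSubgroup_eq_top : U.genSubgroup k = ⊤ := by
  rw [eq_top_iff]
  intro g _
  obtain ⟨s, hs, hsg⟩ := U.exists_mem_genSubgroup k fun i => padicRed (ZMod p) (U.coord g i)
  have h : s⁻¹ * g ∈ U.genSubgroup k := by
    obtain ⟨a, ha⟩ := U.exists_pow_eq (s⁻¹ * g) fun i => by
      rw [← padicRed_eq_zero_iff (ZMod p)]
      have h1 := U.padicRed_coord_mul (ZMod p) s (s⁻¹ * g) i
      rw [mul_inv_cancel_left, hsg] at h1
      exact left_eq_add.1 h1
    rw [← ha]
    exact U.pow_mem_genSubgroup k a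
  simpa using mul_mem hs h

theorem symbol_listProd (w : List ι) :
    U.symbol k w.length (U.listProd k w) = (w.map MvPolynomial.X).prod := by
  induction w with
  | nil => exact U.symbol_one
  | cons i w ih =>
    rw [listProd, List.map_cons, List.prod_cons, ← listProd, List.length_cons, add_comm,
      U.symbol_mul (U.genSub_mem k i) (U.listProd_mem k w), ih, List.map_cons, List.prod_cons,
      genSub, symbol_gen]

/-- The difference is the group commutator minus `1`, times a group element. Landing in `ω ^ 3`
rather than `ω ^ 2` is what makes the graded ring commutative. -/
theorem genSub_commutator_mem (i j : ι) :
    U.genSub k i * U.genSub k j - U.genSub k j * U.genSub k i ∈ augIdeal k G ^ 3 := by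
  obtain ⟨a, ha⟩ := U.exists_pow_eq_commutator (U.gen i) (U.gen j)
  have h1 : U.genSub k i * U.genSub k j - U.genSub k j * U.genSub k i =
      (MonoidAlgebra.of k G (a ^ p ^ U.depth) - 1) * MonoidAlgebra.of k G (U.gen j * U.gen i) := by
    rw [sub_mul, ← map_mul, ha, one_mul, genSub, genSub]
    rw [show U.gen i * U.gen j * (U.gen i)⁻¹ * (U.gen j)⁻¹ * (U.gen j * U.gen i) =
      U.gen i * U.gen j by group, map_mul, map_mul]
    noncomm_ring
  rw [h1]
  exact augIdeal_pow_antitone (U.three_le.trans (Nat.le_add_right _ 0))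
    (augIdeal_pow_mul_mem (sub_one_mem_augIdeal_pow a _) (mem_augIdeal_pow_zero _))

theorem listProd_sub_mem_of_perm {w w' : List ι} (h : w.Perm w') :
    U.listProd k w - U.listProd k w' ∈ augIdeal k G ^ (w.length + 1) := by
  induction h with
  | nil => rw [sub_self]; exact zero_mem _
  | @cons i w w' _ ih =>
    simp only [listProd, List.map_cons, List.prod_cons, List.length_cons] at ih ⊢
    rw [← mul_sub, add_comm w.length 1, add_assoc]
    exact augIdeal_pow_mul_mem (U.genSub_mem k i) ih
  | swap i j w =>
    simp only [listProd, List.map_cons, List.prod_cons, List.length_cons]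
    rw [← mul_assoc, ← mul_assoc, ← sub_mul]
    refine augIdeal_pow_antitone (by omega)
      (augIdeal_pow_mul_mem (U.genSub_commutator_mem k j i) (U.listProd_mem k w))
  | trans h1 _ ih1 ih2 =>
    rw [← h1.length_eq] at ih2
    rw [← sub_add_sub_cancel]
    exact add_mem ih1 ih2

/-- Modulo `ω ^ (n + 1)`, each factor `g - 1` may be replaced by a combination of the `gen i - 1`.
-/
theorem exists_mem_listSpan {n : ℕ} {x : MonoidAlgebra k G} (hx : x ∈ augIdeal k G ^ n) :
    ∃ y ∈ U.listSpan k n, x - y ∈ augIdeal k G ^ (n + 1) := by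
  induction n generalizing x with
  | zero =>
    refine ⟨algebraMap k _ (MonoidAlgebra.lift k k G (1 : G →* k) x), ?_, ?_⟩
    · rw [Algebra.algebraMap_eq_smul_one]
      exact Submodule.smul_mem _ _ (Submodule.subset_span ⟨[], rfl, rfl⟩)
    · rw [zero_add, Submodule.pow_one, augIdeal, RingHom.mem_ker, map_sub, AlgHom.commutes]
      exact sub_self _
  | succ n ih =>
    refine augIdeal_pow_succ_induction (motive := fun x =>
      ∃ y ∈ U.listSpan k (n + 1), x - y ∈ augIdeal k G ^ (n + 1 + 1)) ?_ ?_ hx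
    · rintro x x' ⟨y, hy, hxy⟩ ⟨y', hy', hxy'⟩
      exact ⟨y + y', add_mem hy hy', by rw [add_sub_add_comm]; exact add_mem hxy hxy'⟩
    · intro x hx g
      obtain ⟨y, hy, hxy⟩ := ih hx
      obtain ⟨z, hz, hgz⟩ : g ∈ U.genSubgroup k := by rw [genSubgroup_eq_top]; trivial
      refine ⟨y * z, U.listSpan_mul_genSpan k hy hz, ?_⟩
      have h1 : x * (MonoidAlgebra.of k G g - 1) - y * z =
          (x - y) * (MonoidAlgebra.of k G g - 1) + y * (MonoidAlgebra.of k G g - 1 - z) := by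
        noncomm_ring
      rw [h1]
      exact add_mem (augIdeal_pow_mul_sub_one_mem hxy g)
        (augIdeal_pow_mul_mem (m := n) (n := 2) (U.listSpan_le k hy) hgz)

variable {k}

/-- It suffices to check words; the section returns the same word reordered, which is harmless
modulo `ω ^ (n + 1)`. -/
theorem sub_symbolSection_mem {n : ℕ} {x : MonoidAlgebra k G} (hx : x ∈ augIdeal k G ^ n) :
    x - U.symbolSection k (U.symbol k n x) ∈ augIdeal k G ^ (n + 1) := by
  obtain ⟨y, hy, hxy⟩ := U.exists_mem_listSpan k hx
  have h1 := U.symbol_eq_zero hxy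
  rw [map_sub, sub_eq_zero] at h1
  rw [h1, ← sub_add_sub_cancel x y]
  refine add_mem hxy ?_
  clear h1 hxy
  induction hy using Submodule.span_induction with
  | mem y hy =>
    obtain ⟨w, rfl, rfl⟩ := hy
    rw [symbol_listProd, symbolSection_prod_X]
    exact U.listProd_sub_mem_of_perm k
      (Multiset.coe_eq_coe.1 (Multiset.coe_toList (w : Multiset ι)).symm)
  | zero => simp
  | add y y' _ _ hy hy' =>
    rw [map_add, map_add, add_sub_add_comm]
    exact add_mem hy hy'
  | smul c y _ hy =>
    rw [map_smul, map_smul, ← smul_sub]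
    exact smul_mem_ideal c hy

theorem symbol_eq_zero_iff {n : ℕ} {x : MonoidAlgebra k G} (hx : x ∈ augIdeal k G ^ n) :
    U.symbol k n x = 0 ↔ x ∈ augIdeal k G ^ (n + 1) := by
  refine ⟨fun h => ?_, U.symbol_eq_zero⟩
  have h1 := U.sub_symbolSection_mem hx
  rwa [h, map_zero, sub_zero] at h1

end UniformCoords

/-! ### The structure of the group ring -/

namespace UniformCoords

variable {p : ℕ} [Fact p.Prime] {ι : Type*} [Fintype ι] [DecidableEq ι] {G : Type*} [Group G]
  (U : UniformCoords p ι G) (k : Type*) [Field k] [CharP k p]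

theorem iInf_augIdeal_pow (U : UniformCoords p ι G) : ⨅ n : ℕ, augIdeal k G ^ n = ⊥ := by
  refine iInf_augIdeal_pow_eq_bot fun g h hgh => ?_
  obtain ⟨i, hi⟩ := Function.ne_iff.1 (U.coord_injective.ne hgh)
  obtain ⟨n, hn⟩ := exists_modChoose_ne k hi
  exact ⟨U.linChoose k (Pi.single i 1) n, ⟨_, U.linChoose_mem k _ n⟩, by simpa [linChoose] using hn⟩

theorem exists_symbol_ne_zero {x : MonoidAlgebra k G} (hx : x ≠ 0) :
    ∃ n, x ∈ augIdeal k G ^ n ∧ U.symbol k n x ≠ 0 := by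
  classical
  have h : ∃ n, x ∉ augIdeal k G ^ n := by
    by_contra! h
    refine hx ((Submodule.mem_bot _).1 (?_ : x ∈ (⊥ : Ideal (MonoidAlgebra k G))))
    rw [← U.iInf_augIdeal_pow k]
    exact (Submodule.mem_iInf _).2 h
  have h1 := Nat.find_spec h
  obtain ⟨n, hn⟩ : ∃ n, Nat.find h = n + 1 := Nat.exists_eq_succ_of_ne_zero fun h0 => by
    rw [h0] at h1
    exact h1 (mem_augIdeal_pow_zero x)
  have h2 : x ∈ augIdeal k G ^ n := not_not.1 (Nat.find_min h (by omega))
  exact ⟨n, h2, fun h3 => h1 (hn ▸ (U.symbol_eq_zero_iff h2).1 h3)⟩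

theorem isDomain_monoidAlgebra (U : UniformCoords p ι G) : IsDomain (MonoidAlgebra k G) := by
  have : NoZeroDivisors (MonoidAlgebra k G) := ⟨fun {x y} hxy => by
    by_contra! h
    obtain ⟨m, hm, hxm⟩ := U.exists_symbol_ne_zero k h.1
    obtain ⟨n, hn, hyn⟩ := U.exists_symbol_ne_zero k h.2
    have h1 := U.symbol_mul hm hn
    rw [hxy, map_zero] at h1
    exact mul_ne_zero hxm hyn h1.symm⟩
  exact NoZeroDivisors.to_isDomain _

/-- The symbol map on a graded piece of the group ring. -/
def symbolPiece (n : ℕ) : GrPiece (augIdeal k G) n →ₗ[k] MvPolynomial ι k where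
  toFun := Quotient.lift (fun x : ↥(augIdeal k G ^ n) => U.symbol k n x) fun x y h => by
    have h1 : (x - y : MonoidAlgebra k G) ∈ augIdeal k G ^ (n + 1) :=
      (GrPiece.mk_eq_mk _).1 (Quotient.sound h)
    simpa [sub_eq_zero] using U.symbol_eq_zero h1
  map_add' a b := by
    obtain ⟨x, rfl⟩ := GrPiece.mk_surjective _ _ a
    obtain ⟨y, rfl⟩ := GrPiece.mk_surjective _ _ b
    exact map_add (U.symbol k n) (x : MonoidAlgebra k G) y
  map_smul' c a := by
    obtain ⟨x, rfl⟩ := GrPiece.mk_surjective _ _ a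
    exact map_smul (U.symbol k n) c (x : MonoidAlgebra k G)

theorem symbolPiece_injective (n : ℕ) : Function.Injective (U.symbolPiece k n) := by
  rw [injective_iff_map_eq_zero]
  intro a ha
  obtain ⟨x, rfl⟩ := GrPiece.mk_surjective _ _ a
  refine (GrPiece.mk_eq_mk _ (y := 0)).2 ?_
  rw [Submodule.coe_zero, sub_zero]
  exact (U.symbol_eq_zero_iff x.2).1 ha

theorem isHomogeneous_symbolPiece (n : ℕ) (a : GrPiece (augIdeal k G) n) :
    (U.symbolPiece k n a).IsHomogeneous n := by
  obtain ⟨x, rfl⟩ := GrPiece.mk_surjective _ _ a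
  exact U.isHomogeneous_symbol n _

theorem symbolPiece_one :
    U.symbolPiece k 0 (GradedMonoid.GOne.one : GrPiece (augIdeal k G) 0) = 1 :=
  U.symbol_one

theorem symbolPiece_mul {m n : ℕ} (a : GrPiece (augIdeal k G) m) (b : GrPiece (augIdeal k G) n) :
    U.symbolPiece k (m + n) (GradedMonoid.GMul.mul a b) =
      U.symbolPiece k m a * U.symbolPiece k n b := by
  obtain ⟨x, rfl⟩ := GrPiece.mk_surjective _ _ a
  obtain ⟨y, rfl⟩ := GrPiece.mk_surjective _ _ b
  exact U.symbol_mul x.2 y.2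

/-- The symbol map, as an algebra homomorphism on the associated graded ring. -/
def symbolHom : AssocGraded (augIdeal k G) →ₐ[k] MvPolynomial ι k :=
  DirectSum.toAlgebra k _ (U.symbolPiece k) (U.symbolPiece_one k) (U.symbolPiece_mul k)

theorem symbolHom_of (n : ℕ) (a : GrPiece (augIdeal k G) n) :
    U.symbolHom k (DirectSum.of _ n a) = U.symbolPiece k n a := by
  rw [symbolHom, DirectSum.toAlgebra_apply]
  exact DirectSum.toAddMonoid_of (fun i => (U.symbolPiece k i).toAddMonoidHom) n a

/-- Injectivity and the grading can thus be read off one degree at a time. -/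
theorem homogeneousComponent_symbolHom (n : ℕ) (a : AssocGraded (augIdeal k G)) :
    MvPolynomial.homogeneousComponent n (U.symbolHom k a) = U.symbolPiece k n (a n) := by
  induction a using DirectSum.induction_on with
  | zero => simp
  | of m a =>
    rw [symbolHom_of, MvPolynomial.homogeneousComponent_of_mem (U.isHomogeneous_symbolPiece k m a)]
    split_ifs with h
    · subst h
      rw [DirectSum.of_eq_same]
    · rw [DirectSum.of_eq_of_ne _ _ _ h, map_zero]
  | add a b ha hb => rw [map_add, map_add, ha, hb, DirectSum.add_apply, map_add]

theorem symbolHom_injective : Function.Injective (U.symbolHom k) := by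
  rw [injective_iff_map_eq_zero]
  intro a ha
  refine DFinsupp.ext fun n => U.symbolPiece_injective k n ?_
  rw [← homogeneousComponent_symbolHom, ha, map_zero]
  exact (map_zero _).symm

theorem symbolHom_surjective : Function.Surjective (U.symbolHom k) := by
  rw [← AlgHom.range_eq_top, eq_top_iff, ← MvPolynomial.adjoin_range_X, Algebra.adjoin_le_iff]
  rintro _ ⟨i, rfl⟩
  exact ⟨DirectSum.of (GrPiece (augIdeal k G)) 1 (GrPiece.mk _ 1 ⟨_, U.genSub_mem k i⟩),
    (U.symbolHom_of k _ _).trans (U.symbol_gen i)⟩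

/-- The associated graded ring of the group ring is a polynomial ring. -/
def symbolEquiv : AssocGraded (augIdeal k G) ≃ₐ[k] MvPolynomial ι k :=
  AlgEquiv.ofBijective (U.symbolHom k) ⟨U.symbolHom_injective k, U.symbolHom_surjective k⟩

theorem exists_of_eq_iff (n : ℕ) (a : AssocGraded (augIdeal k G)) :
    (∃ x : GrPiece (augIdeal k G) n, DirectSum.of (GrPiece (augIdeal k G)) n x = a) ↔
      (U.symbolEquiv k a).IsHomogeneous n := by
  constructor
  · rintro ⟨x, rfl⟩
    exact (congrArg (MvPolynomial.IsHomogeneous · n) (U.symbolHom_of k n x)).mpr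
      (U.isHomogeneous_symbolPiece k n x)
  · intro h
    refine ⟨a n, U.symbolHom_injective k ?_⟩
    rw [symbolHom_of, ← homogeneousComponent_symbolHom]
    exact (MvPolynomial.homogeneousComponent_of_mem h).trans (if_pos rfl)

end UniformCoords

/-! ### Roots in congruence subgroups -/

/-- The leading terms of `(1 + p ^ s * x) ^ p`. -/
theorem pow_dvd_one_add_pow_sub {R : Type*} [CommRing R] {p : ℕ} (hp : p.Prime) {s : ℕ}
    (hs : 0 < s) (hs2 : p = 2 → 2 ≤ s) (x : R) :
    (p : R) ^ (s + 2) ∣ (1 + (p : R) ^ s * x) ^ p - 1 - (p : R) ^ (s + 1) * x := by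
  have hp2 := hp.two_le
  have h1 : (1 + (p : R) ^ s * x) ^ p - 1 - (p : R) ^ (s + 1) * x =
      ∑ j ∈ Finset.range (p - 1), ((p : R) ^ s * x) ^ (j + 2) * (p.choose (j + 2) : R) := by
    rw [add_comm 1, add_pow, show p + 1 = p - 1 + 1 + 1 by omega, Finset.sum_range_succ',
      Finset.sum_range_succ']
    simp only [one_pow, mul_one, zero_add, pow_one, Nat.choose_one_right, pow_zero,
      Nat.choose_zero_right, Nat.cast_one, add_assoc, one_add_one_eq_two]
    ring
  rw [h1]
  refine Finset.dvd_sum fun j hj => ?_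
  rw [Finset.mem_range] at hj
  rw [mul_pow, ← pow_mul]
  -- Middle binomial coefficients supply one more `p`; the last term needs `s * p ≥ s + 2`, which
  -- for `p = 2` forces `s ≥ 2`.
  rcases (by omega : j + 2 < p ∨ j + 2 = p) with h | h
  · obtain ⟨c, hc⟩ := hp.dvd_choose_self (by omega) h
    rw [hc, Nat.cast_mul, show (p : R) ^ (s * (j + 2)) * x ^ (j + 2) * ((p : R) * c) =
      (p : R) ^ (s * (j + 2) + 1) * (x ^ (j + 2) * c) by ring]
    exact (pow_dvd_pow _ (by nlinarith)).mul_right _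
  · refine ((pow_dvd_pow _ ?_).mul_right _).mul_right _
    rcases j with _ | j
    · have := hs2 h.symm
      omega
    · nlinarith

/-- Every element congruent to `1` modulo `p ^ (s + 1)` is approximated by `p`-th powers. -/
theorem exists_one_add_pow_eq {R : Type*} [CommRing R] {p : ℕ} (hp : p.Prime) {s : ℕ}
    (hs : 0 < s) (hs2 : p = 2 → 2 ≤ s) (x : R) (n : ℕ) : ∃ y w : R,
    (1 + (p : R) ^ s * y) ^ p = 1 + (p : R) ^ (s + 1) * x + (p : R) ^ (s + 1 + n) * w := by
  induction n with
  | zero => exact ⟨0, -x, by ring⟩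
  | succ n ih =>
    obtain ⟨y, w, h⟩ := ih
    obtain ⟨v, hv⟩ := pow_dvd_one_add_pow_sub (s := s + n) hp (by omega)
      (fun h => (hs2 h).trans (by omega)) (-w)
    -- The approximate root is multiplied by `1 - p ^ (s + n) * w`, whose `p`-th power cancels the
    -- error to leading order.
    refine ⟨y - (p : R) ^ n * w - (p : R) ^ (s + n) * y * w, v - (p : R) ^ s * x * w -
      (p : R) ^ (s + n) * w ^ 2 + ((p : R) ^ (s + 1) * x + (p : R) ^ (s + 1 + n) * w) * v, ?_⟩
    have h1 : (1 + (p : R) ^ s * (y - (p : R) ^ n * w - (p : R) ^ (s + n) * y * w)) =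
        (1 + (p : R) ^ s * y) * (1 + (p : R) ^ (s + n) * -w) := by ring
    rw [h1, mul_pow, h, show (1 + (p : R) ^ (s + n) * -w) ^ p = 1 + (p : R) ^ (s + n + 1) * -w +
      (p : R) ^ (s + n + 2) * v by rw [← hv]; ring]
    ring

theorem exists_matrix_pow_eq {p : ℕ} [Fact p.Prime] {d s : ℕ} (hs : 0 < s) (hs2 : p = 2 → 2 ≤ s)
    (X : Matrix (Fin d) (Fin d) ℤ_[p]) : ∃ Y : Matrix (Fin d) (Fin d) ℤ_[p],
    (1 + (p : ℤ_[p]) ^ s • Y) ^ p = 1 + (p : ℤ_[p]) ^ (s + 1) • X := by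
  have key : ∀ n : ℕ, ∃ Y W : Matrix (Fin d) (Fin d) ℤ_[p], (1 + (p : ℤ_[p]) ^ s • Y) ^ p =
      1 + (p : ℤ_[p]) ^ (s + 1) • X + (p : ℤ_[p]) ^ (s + 1 + n) • W := fun n => by
    -- Solving over the commutative ring of polynomials and evaluating at `X` avoids noncommuting
    -- matrices.
    obtain ⟨y, w, h⟩ := exists_one_add_pow_eq (Fact.out : p.Prime) hs hs2
      (Polynomial.X : Polynomial ℤ_[p]) n
    refine ⟨Polynomial.aeval X y, Polynomial.aeval X w, ?_⟩
    have h1 := congrArg (Polynomial.aeval X) h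
    simp only [map_pow, map_add, map_mul, map_one, map_natCast, Polynomial.aeval_X] at h1
    simpa only [Algebra.smul_def, map_pow, map_natCast] using h1
  choose Y W h using key
  have : CompactSpace (Matrix (Fin d) (Fin d) ℤ_[p]) :=
    inferInstanceAs (CompactSpace (Fin d → Fin d → ℤ_[p]))
  have hc : Continuous fun Y : Matrix (Fin d) (Fin d) ℤ_[p] => (1 + (p : ℤ_[p]) ^ s • Y) ^ p :=
    (continuous_const.add (continuous_const_smul _)).pow p
  -- The `Y n` need not converge: the set of values of the power map is compact, hence closed, and
  -- contains the limit.
  suffices H : Filter.Tendsto (fun n => (1 + (p : ℤ_[p]) ^ s • Y n) ^ p) Filter.atTop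
      (nhds (1 + (p : ℤ_[p]) ^ (s + 1) • X)) from
    (isCompact_range hc).isClosed.mem_of_tendsto H (Filter.Eventually.of_forall fun n => ⟨Y n, rfl⟩)
  simp only [h]
  refine tendsto_pi_nhds.2 fun a => tendsto_pi_nhds.2 fun b => ?_
  have h0 : Filter.Tendsto (fun n => (p : ℤ_[p]) ^ (s + 1 + n) * W n a b) Filter.atTop
      (nhds 0) := by
    have hp1 : ‖(p : ℤ_[p])‖ < 1 := (PadicInt.norm_lt_one_iff_dvd _).2 dvd_rfl
    refine squeeze_zero_norm (a := fun n => ‖(p : ℤ_[p])‖ ^ n) (fun n => ?_)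
      (tendsto_pow_atTop_nhds_zero_of_lt_one (norm_nonneg _) hp1)
    rw [norm_mul, norm_pow, pow_add]
    refine (mul_le_of_le_one_right (by positivity) (PadicInt.norm_le_one _)).trans ?_
    exact mul_le_of_le_one_left (by positivity)
      (pow_le_one₀ (norm_nonneg _) hp1.le)
  simpa using h0.const_add ((1 + (p : ℤ_[p]) ^ (s + 1) • X) a b)

theorem congruentToOne_iff {i d p : ℕ} [Fact p.Prime] {A : Matrix (Fin d) (Fin d) ℤ_[p]} :
    CongruentToOne i d p A ↔ ∃ X : Matrix (Fin d) (Fin d) ℤ_[p], 1 + (p : ℤ_[p]) ^ i • X = A := by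
  constructor
  · intro h
    choose X hX using h
    refine ⟨X, ?_⟩
    rw [← sub_add_cancel A 1, add_comm]
    congr 1
    ext a b
    exact (hX a b).symm
  · rintro ⟨X, rfl⟩ a b
    exact ⟨X a b, by simp⟩

/-- Each extraction of a `p`-th root lowers the congruence level by one. -/
theorem exists_mem_congruenceSubgroup_pow_eq {p d s : ℕ} [Fact p.Prime] (hs : 0 < s)
    (hs2 : p = 2 → 2 ≤ s) (n : ℕ) {g : Matrix.GeneralLinearGroup (Fin d) ℤ_[p]}
    (hg : g ∈ congruenceSubgroup (s + n) d p) : ∃ h ∈ congruenceSubgroup s d p, h ^ p ^ n = g := by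
  induction n generalizing g with
  | zero => exact ⟨g, hg, by simp⟩
  | succ n ih =>
    obtain ⟨X, hX⟩ := congruentToOne_iff.1 hg
    obtain ⟨Y, hY⟩ := exists_matrix_pow_eq (s := s + n) (by omega)
      (fun h => (hs2 h).trans (by omega)) X
    obtain ⟨h, hh, hhY⟩ := exists_mem_congruenceSubgroup (i := s + n) (by omega)
      (congruentToOne_iff.2 ⟨Y, rfl⟩)
    obtain ⟨f, hf, rfl⟩ := ih hh
    refine ⟨f, hf, ?_⟩
    rw [pow_succ, pow_mul]
    refine Units.ext ?_
    rw [Units.val_pow_eq_pow_val, hhY, hY]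
    exact hX

/-- For `g = 1 + p ^ m X` and `h = 1 + p ^ n Y`, `g h - h g = p ^ (m + n) (X Y - Y X)`; then
multiply by the inverse of `h g`. -/
theorem commutator_mem_congruenceSubgroup {p d m n : ℕ} [Fact p.Prime]
    {g h : Matrix.GeneralLinearGroup (Fin d) ℤ_[p]} (hg : g ∈ congruenceSubgroup m d p)
    (hh : h ∈ congruenceSubgroup n d p) :
    g * h * g⁻¹ * h⁻¹ ∈ congruenceSubgroup (m + n) d p := by
  obtain ⟨X, hX⟩ := congruentToOne_iff.1 hg
  obtain ⟨Y, hY⟩ := congruentToOne_iff.1 hh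
  refine congruentToOne_iff.2 ⟨(X * Y - Y * X) * ((g⁻¹ : _ˣ) * (h⁻¹ : _ˣ)), ?_⟩
  have h1 : (p : ℤ_[p]) ^ (m + n) • (X * Y - Y * X) = (g : Matrix (Fin d) (Fin d) ℤ_[p]) * h -
      (h : Matrix (Fin d) (Fin d) ℤ_[p]) * g := by
    rw [← hX, ← hY]
    simp only [add_mul, mul_add, one_mul, mul_one, smul_mul_smul_comm, ← pow_add, smul_sub,
      add_comm n m]
    abel
  rw [← smul_mul_assoc, h1, sub_mul]
  have h2 : (h : Matrix (Fin d) (Fin d) ℤ_[p]) * g * ((g⁻¹ : _ˣ) * (h⁻¹ : _ˣ)) = 1 := by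
    rw [mul_assoc, Units.mul_inv_cancel_left, Units.mul_inv]
  rw [h2, add_sub_cancel, ← mul_assoc]
  rfl

/-! ### Coordinates on congruence subgroups -/

section CongruenceCoord

variable {u d p : ℕ} [Fact p.Prime]

/-- The entries of `(g - 1) / p ^ u`. -/
def congruenceCoord (g : congruenceSubgroup u d p) (i : Fin d × Fin d) : ℤ_[p] :=
  (g.2 i.1 i.2).choose

theorem congruenceCoord_spec (g : congruenceSubgroup u d p) (a b : Fin d) :
    ((g : Matrix.GeneralLinearGroup (Fin d) ℤ_[p]) : Matrix (Fin d) (Fin d) ℤ_[p]) a b =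
      (1 : Matrix (Fin d) (Fin d) ℤ_[p]) a b + (p : ℤ_[p]) ^ u * congruenceCoord g (a, b) := by
  rw [← sub_eq_iff_eq_add']
  exact (g.2 a b).choose_spec

theorem prime_pow_ne_zero : (p : ℤ_[p]) ^ u ≠ 0 :=
  pow_ne_zero _ (Nat.cast_ne_zero.2 (Fact.out : p.Prime).ne_zero)

theorem exists_congruenceSubgroup_eq (hu : 0 < u) (X : Matrix (Fin d) (Fin d) ℤ_[p]) :
    ∃ g : congruenceSubgroup u d p,
      ((g : Matrix.GeneralLinearGroup (Fin d) ℤ_[p]) : Matrix (Fin d) (Fin d) ℤ_[p]) =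
        1 + (p : ℤ_[p]) ^ u • X := by
  obtain ⟨g, hg, h⟩ := exists_mem_congruenceSubgroup hu (congruentToOne_iff.2 ⟨X, rfl⟩)
  exact ⟨⟨g, hg⟩, h⟩

theorem congruenceCoord_eq {g : congruenceSubgroup u d p} {X : Matrix (Fin d) (Fin d) ℤ_[p]}
    (h : ((g : Matrix.GeneralLinearGroup (Fin d) ℤ_[p]) : Matrix (Fin d) (Fin d) ℤ_[p]) =
      1 + (p : ℤ_[p]) ^ u • X) (a b : Fin d) : congruenceCoord g (a, b) = X a b := by
  have h1 := congruenceCoord_spec g a b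
  rw [h, Matrix.add_apply, Matrix.smul_apply, smul_eq_mul] at h1
  exact (mul_left_cancel₀ prime_pow_ne_zero (add_left_cancel h1)).symm

theorem congruenceCoord_mul (g h : congruenceSubgroup u d p) (a b : Fin d) :
    congruenceCoord (h * g) (a, b) = congruenceCoord g (a, b) + (p : ℤ_[p]) ^ u *
      ∑ e, congruenceCoord h (a, e) * congruenceCoord g (e, b) + congruenceCoord h (a, b) := by
  refine mul_left_cancel₀ (prime_pow_ne_zero (p := p) (u := u))
    (add_left_cancel (a := (1 : Matrix (Fin d) (Fin d) ℤ_[p]) a b) ?_)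
  rw [← congruenceCoord_spec, Subgroup.coe_mul, Units.val_mul, Matrix.mul_apply]
  simp only [congruenceCoord_spec, add_mul, mul_add, Finset.sum_add_distrib, ← Matrix.mul_apply,
    mul_one]
  simp only [Matrix.one_apply, ite_mul, one_mul, zero_mul, mul_ite, mul_one, mul_zero,
    Finset.sum_ite_eq, Finset.sum_ite_eq', Finset.mem_univ, if_true, Finset.mul_sum]
  rw [Finset.sum_congr rfl fun e _ => (by ring : (p : ℤ_[p]) ^ u * congruenceCoord h (a, e) *
    ((p : ℤ_[p]) ^ u * congruenceCoord g (e, b)) = (p : ℤ_[p]) ^ u * ((p : ℤ_[p]) ^ u *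
      (congruenceCoord h (a, e) * congruenceCoord g (e, b))))]
  ring

/-- The coordinates on a congruence subgroup. -/
def congruenceCoords (hu : 0 < u) (hp : p = 2 → 2 ≤ u) :
    UniformCoords p (Fin d × Fin d) (congruenceSubgroup u d p) where
  coord := congruenceCoord
  depth := u
  three_le := by
    have h2 := (Fact.out : p.Prime).two_le
    rcases h2.lt_or_eq with h | h
    · exact h.trans_le (Nat.le_self_pow hu.ne' p)
    · rw [← h]
      exact (by norm_num : 3 ≤ 2 ^ 2).trans (Nat.pow_le_pow_right (by norm_num) (hp h.symm))
  exists_dotProduct_mul c g := by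
    -- The coefficient of the entry `i` of `h` in the form `c` applied to the matrix product of the
    -- coordinates of `h` and `g`.
    refine ⟨fun i => ∑ b, c (i.1, b) * congruenceCoord g (i.2, b), fun h => ?_⟩
    simp only [dotProduct, Fintype.sum_prod_type, congruenceCoord_mul, mul_add,
      Finset.sum_add_distrib, Finset.mul_sum, Finset.sum_mul]
    congr 2
    refine Finset.sum_congr rfl fun a _ => ?_
    rw [Finset.sum_comm]
    refine Finset.sum_congr rfl fun e _ => Finset.sum_congr rfl fun b _ => ?_
    ring
  coord_injective g h hgh := by
    refine Subtype.ext (Units.ext ?_)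
    ext a b
    rw [congruenceCoord_spec, congruenceCoord_spec, hgh]
  gen i := (exists_congruenceSubgroup_eq hu (Matrix.single i.1 i.2 1)).choose
  coord_gen i := by
    ext ⟨a, b⟩
    rw [congruenceCoord_eq (exists_congruenceSubgroup_eq hu (Matrix.single i.1 i.2 1)).choose_spec,
      Matrix.single_apply, Pi.single_apply]
    exact if_congr (by rw [Prod.ext_iff, eq_comm, @eq_comm _ i.2]) rfl rfl
  exists_pow_eq g hg := by
    obtain ⟨h, hh, hhg⟩ := exists_mem_congruenceSubgroup_pow_eq (g := g.1) hu hp 1 fun a b => by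
      rw [Matrix.sub_apply, congruenceCoord_spec, add_sub_cancel_left, pow_succ]
      exact mul_dvd_mul_left _ (hg (a, b))
    exact ⟨⟨h, hh⟩, Subtype.ext (by rw [← hhg, pow_one]; rfl)⟩
  exists_pow_eq_commutator g h := by
    -- The commutator has level `u + u`, so a `p ^ u`-th root of it exists at level `u`.
    obtain ⟨a, ha, hag⟩ := exists_mem_congruenceSubgroup_pow_eq hu hp u
      (commutator_mem_congruenceSubgroup g.2 h.2)
    exact ⟨⟨a, ha⟩, Subtype.ext hag⟩

end CongruenceCoord
end

theorem corollary3p4 (u d p : ℕ) [Fact p.Prime] (hu : 0 < u) (hd : 0 < d)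
    (hp : p = 2 → 2 ≤ u) (k : Type*) [Field k] [CharP k p] :
    (∃ φ : AssocGraded (augIdeal k (congruenceSubgroup u d p)) ≃ₐ[k]
        MvPolynomial (Fin (d ^ 2)) k,
      ∀ (n : ℕ) (a : AssocGraded (augIdeal k (congruenceSubgroup u d p))),
        (∃ x : GrPiece (augIdeal k (congruenceSubgroup u d p)) n,
          DirectSum.of (GrPiece (augIdeal k (congruenceSubgroup u d p))) n x = a) ↔
        (φ a).IsHomogeneous n) ∧
    (⨅ n : ℕ, augIdeal k (congruenceSubgroup u d p) ^ n) = ⊥ ∧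
    IsDomain (MonoidAlgebra k (congruenceSubgroup u d p)) := by
  let U := congruenceCoords (d := d) hu hp
  let e : Fin d × Fin d ≃ Fin (d ^ 2) := finProdFinEquiv.trans (finCongr (sq d).symm)
  refine ⟨⟨(U.symbolEquiv k).trans (MvPolynomial.renameEquiv k e), fun n a => ?_⟩,
    U.iInf_augIdeal_pow k, U.isDomain_monoidAlgebra k⟩
  rw [U.exists_of_eq_iff k n a]
  exact (MvPolynomial.IsHomogeneous.rename_isHomogeneous_iff e.injective).symm
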